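/- **Setting.** In weighted paging there are $n$ pages with weights $w(p)>0$ and a cache of size $k$, $1\le k<n$, initially empty. Each requested page must be in the cache after its request has been served; the cost is the total weight of the evicted pages. For an input $B=(B_1,\dots,B_N)$, let $\mathsf{OPT}$ be the minimum cost of serving $B$ offline with a cache of size $k$. In the SPRP model ("strong per-request prediction") there is also a prediction sequence $A=(A_1,\dots,A_m)$ of pages, not known in advance. At time $t$ the online algorithm sees the request $B_t$, the predicted time $\mathrm{pnext}(t)=\min\{i>t: A_i=B_t\}$ of the next request for that page ($m+1$ if there is no such $i$), and the predicted requests $A_{t+1},A_{t+2},\dots$ up to that time. Let $\mathrm{next}(t)=\min\{i>t: B_i=B_t\}$ ($N+1$ if there is no such $i$), and let $$\ell_{pd}=\sum_{t=1}^{N} w(B_t)\cdot|\mathrm{next}(t)-\mathrm{pnext}(t)|.$$ A randomized algorithm is a probability distribution on deterministic online algorithms; its cost on a fixed instance $(w,A,B)$ is the expected cost. Algorithms know $n,k,w$. **Theorem 4.** For weighted paging with SPRP there is no deterministic algorithm whose cost is $o(k)\cdot\mathsf{OPT}+o(\ell_{pd})$, and no randomized algorithm whose cost is $o(\log k)\cdot\mathsf{OPT}+o(\ell_{pd})$.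 Explicitly: 1. There is an absolute constant $\delta>0$ such that for all $1\le k<n$, every deterministic algorithm for $n$ pages and cache size $k$, and every $X\in\mathbb R$, some instance $(w,A,B)$ has $\ell_{pd}\ge X$ and $\mathrm{cost}>\delta\,(k\cdot\mathsf{OPT}+\ell_{pd})$. 2. There is an absolute constant $\delta>0$ such that for all $1\le k<n$, every randomized algorithm for $n$ pages and cache size $k$, and every $X\in\mathbb R$, some instance $(w,A,B)$ has $\ell_{pd}\ge X$ and $\mathbb E[\mathrm{cost}]>\delta\,(\log k\cdot\mathsf{OPT}+\ell_{pd})$. 3. Let $f(k)=o(k)$ as $k\to\infty$ and, for each $k$, $g_k(x)=o(x)$ as $x\to\infty$. There is no family of deterministic algorithms, one for each pair $1\le k<n$, with $\mathrm{cost}\le f(k)\cdot\mathsf{OPT}+g_k(\ell_{pd})$ on all instances. 4. Let $f(k)=o(\log k)$ as $k\to\infty$ and, for each $k$, $g_k(x)=o(x)$ as $x\to\infty$. There is no family of randomized algorithms, one for each pair $1\le k<n$, with $\mathbb E[\mathrm{cost}]\le f(k)\cdot\mathsf{OPT}+g_k(\ell_{pd})$ on all instances. 5. In particular, the analogue of the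 bound of Lykouris and Vassilvitskii for unweighted paging fails: for no constant $c$ is there a family of (deterministic or randomized) algorithms, one for each pair $1\le k<n$, with expected cost at most $c\,(\mathsf{OPT}+\sqrt{\ell_{pd}\cdot\mathsf{OPT}})$ on all instances. -/

import Mathlib

open Filter Asymptotics MeasureTheory

namespace WeightedPaging

/-- Time steps are numbered `1, 2, …`. `nextOcc S p t` is the smallest `i > t` such that the `i`-th
element of `S` is `p`, and `S.length + 1` if there is no such `i`. -/
def nextOcc {n : ℕ} (S : List (Fin n)) (p : Fin n) (t : ℕ) : ℕ :=
  if p ∈ S.drop t then t + (S.drop t).idxOf p + 1 else S.length + 1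

/-- What an online algorithm with strong per-request predictions (SPRP) sees at one time step:
the requested page, the predicted time of the next request for that page, and the predicted
requests from the next time step up to (and including) that time. -/
structure Observation (n : ℕ) where
  request : Fin n
  nextTime : ℕ
  upcoming : List (Fin n)

/-- The observation at time `t`, if page `p` is requested at time `t` and `A` is the prediction
sequence. -/
def observe {n : ℕ} (A : List (Fin n)) (p : Fin n) (t : ℕ) : Observation n where
  request := p
  nextTime := nextOcc A p t
  upcoming := (A.drop t).take (nextOcc A p t - t)

/-- The observations at times `1, 2, …, B.length` on prediction sequence `A` and input `B`. -/
def observations {n : ℕ} (A B : List (Fin n)) : List (Observation n) :=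
  (B.zipIdx 1).map fun x => observe A x.1 x.2

/-- The prediction distance `ℓ_pd` between prediction sequence `A` and input sequence `B`. -/
noncomputable def predictionDistance {n : ℕ} (w : Fin n → ℝ) (A B : List (Fin n)) : ℝ :=
  ∑ i : Fin B.length,
    w (B.get i) *
      |(nextOcc B (B.get i) (i.val + 1) : ℝ) - (nextOcc A (B.get i) (i.val + 1) : ℝ)|

/-- Total weight of the pages evicted in the first `T` time steps, where `C t` is the cache content
after time step `t`. -/
noncomputable def evictionCost {n : ℕ} (w : Fin n → ℝ) (T : ℕ) (C : ℕ → Finset (Fin n)) : ℝ :=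
  ∑ t ∈ Finset.range T, ∑ p ∈ C t \ C (t + 1), w p

/-- `C` is a valid way to serve the requests `B` with a cache of size `k`, initially empty. -/
structure Feasible {n : ℕ} (k : ℕ) (B : List (Fin n)) (C : ℕ → Finset (Fin n)) : Prop where
  init : C 0 = ∅
  card_le : ∀ t, (C t).card ≤ k
  serves : ∀ i : Fin B.length, B.get i ∈ C (i.val + 1)

/-- The optimal offline cost of serving `B` with a cache of size `k`. -/
noncomputable def optCost {n : ℕ} (w : Fin n → ℝ) (k : ℕ) (B : List (Fin n)) : ℝ :=
  sInf {x : ℝ | ∃ C : ℕ → Finset (Fin n), Feasible k B C ∧ x = evictionCost w B.length C}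

/-- A deterministic online algorithm with SPRP, for `n` pages and cache size `k`. It knows the
weights, and it chooses the cache content after each time step from the observations
up to and including that time step (the latest one is the last element of the list). -/
structure DetAlg (n k : ℕ) where
  cache : (Fin n → ℝ) → List (Observation n) → Finset (Fin n)
  card_le : ∀ w h, (cache w h).card ≤ k
  serves : ∀ w h o, o.request ∈ cache w (h ++ [o])

/-- The cache content after time step `t`, starting from an empty cache. -/
def DetAlg.schedule {n k : ℕ} (a : DetAlg n k) (w : Fin n → ℝ) (A B : List (Fin n)) (t : ℕ) :
    Finset (Fin n) :=
  if t = 0 then ∅ else a.cache w ((observations A B).take t)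

/-- The cost of the algorithm on prediction sequence `A` and input sequence `B`. -/
noncomputable def DetAlg.cost {n k : ℕ} (a : DetAlg n k) (w : Fin n → ℝ) (A B : List (Fin n)) : ℝ :=
  evictionCost w B.length (a.schedule w A B)

/-- The σ-algebra on deterministic algorithms that is generated by all their decisions. -/
instance DetAlg.measurableSpace (n k : ℕ) : MeasurableSpace (DetAlg n k) :=
  ⨆ (w : Fin n → ℝ) (h : List (Observation n)),
    MeasurableSpace.comap (fun a : DetAlg n k => a.cache w h) ⊤

/-- A randomized online algorithm with SPRP: a probability distribution on deterministic ones. -/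
abbrev RandAlg (n k : ℕ) := ProbabilityMeasure (DetAlg n k)

/-- The expected cost of a randomized algorithm on a fixed (oblivious) input. -/
noncomputable def RandAlg.expectedCost {n k : ℕ} (R : RandAlg n k) (w : Fin n → ℝ)
    (A B : List (Fin n)) : ℝ :=
  ∫ a : DetAlg n k, a.cost w A B ∂(R : Measure (DetAlg n k))

end WeightedPaging

namespace WeightedPaging

/-! The hard instances embed the parking permit problem into paging with `k + 1` pages. Days are
grouped into nested intervals of `M ^ j` days. Page `j < k` is requested on the first day of every
level-`j` interval, and a demand is a request of the almost weightless page `k` at the end of a day.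
On a demand day some page `j < k` is missing, so it was evicted since the current level-`j` interval
began: the algorithm has paid `w j` for a permit for that interval (`permitCost_le_cost`).
Conversely, any choice of permits gives an offline schedule of the same cost up to a negligible term
(`optCost_demandInput_le`). The prediction is the input without demands, so it reveals nothing about
them, yet each demand adds at most twice the cheapest permit to the prediction distance
(`predictionDistance_le`). Hence that distance is comparable to what must be paid anyway, and lower
bounds for permits transfer to paging. Scaling the weights makes the distance as large as desired.

Deterministic case: demands come exactly on the days that the permits bought so far leave uncovered.
A level-`i` interval with a demand then costs the algorithm about `w i`, either in one long permit
or, `k` times over, in short ones. Summing over all levels `i`, the `k` strategies that use one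
fixed level cost together at most four times the online cost, so one of them is cheaper by a factor
of order `k` (`Greedy.exists_level`).

Randomized case: inside an interval, demands occur recursively in its first sub-intervals, and the
process stops after each of them with probability 1/2. The weight ratio of consecutive levels is the
mean number of sub-intervals, so no online strategy has expected cost below the top weight
(`le_demandExpect_onlineCost`). The offline player sees the rare long runs and buys the long permit
only there. Each level saves a fixed fraction until the expected optimum is an `O(1 / log
k)`-fraction of the top weight (`demandExpect_blockOpt_le`). Averaging over the random input gives
one bad input for the randomized algorithm. -/

/-! ### Parking permits and their cost. -/

/-- The cost of permits in the parking permit problem. A permit of level `j < K` costs `w j` and is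
valid on all days with the same quotient by `M ^ j`; on each day `d ∈ S` one needs the permit of
level `q d`. -/
noncomputable def permitCost (M : ℕ) (w : ℕ → ℝ) (K : ℕ) (S : Finset ℕ) (q : ℕ → ℕ) : ℝ :=
  ∑ j ∈ Finset.range K, w j * ((S.filter (q · = j)).image (· / M ^ j)).card

theorem div_pow_div_pow (M d : ℕ) {i j : ℕ} (h : i ≤ j) : d / M ^ i / M ^ (j - i) = d / M ^ j := by
  rw [Nat.div_div_eq_div_mul, ← pow_add, Nat.add_sub_cancel' h]

theorem div_pow_eq_of_le {M d e i j : ℕ} (h : i ≤ j) (hd : d / M ^ i = e / M ^ i) :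
    d / M ^ j = e / M ^ j := by
  rw [← div_pow_div_pow M d h, ← div_pow_div_pow M e h, hd]

theorem le_permitCost {M K : ℕ} {w : ℕ → ℝ} (hw : ∀ j, 0 ≤ w j) {S : Finset ℕ} {q : ℕ → ℕ}
    {d : ℕ} (hd : d ∈ S) (hq : q d < K) : w (q d) ≤ permitCost M w K S q := by
  have h1 : w (q d) * 1 ≤
      w (q d) * (((S.filter (q · = q d)).image (· / M ^ (q d))).card : ℝ) := by
    refine mul_le_mul_of_nonneg_left ?_ (hw _)
    have : 0 < ((S.filter (q · = q d)).image (· / M ^ (q d))).card :=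
      Finset.card_pos.2 ⟨_, Finset.mem_image_of_mem _ (Finset.mem_filter.2 ⟨hd, rfl⟩)⟩
    exact_mod_cast this
  rw [mul_one] at h1
  exact h1.trans (Finset.single_le_sum
    (f := fun j => w j * (((S.filter (q · = j)).image (· / M ^ j)).card : ℝ))
    (fun j _ => mul_nonneg (hw j) (Nat.cast_nonneg _)) (Finset.mem_range.2 hq))

theorem permitCost_const {M K : ℕ} {w : ℕ → ℝ} {S : Finset ℕ} {i : ℕ} (hi : i < K) :
    permitCost M w K S (fun _ => i) = w i * (S.image (· / M ^ i)).card := by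
  unfold permitCost
  rw [Finset.sum_eq_single i]
  · simp
  · intro j _ hj
    simp [Ne.symm hj]
  · simp [hi]

/-! ### The adaptive adversary against deterministic permit strategies. -/

/-- The days, up to day `d`, on which an adversary demands a permit: those that are not covered by
the permits `q` used before. -/
def uncovered (M : ℕ) (q : Finset ℕ → ℕ → ℕ) : ℕ → Finset ℕ
  | 0 => ∅
  | d + 1 =>
    let S := uncovered M q d
    if ∃ e ∈ S, e / M ^ q (S.filter (· ≤ e)) e = d / M ^ q (S.filter (· ≤ e)) e then S
    else insert d S

section uncovered
variable {M : ℕ} {q : Finset ℕ → ℕ → ℕ}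

theorem lt_of_mem_uncovered {d e : ℕ} (h : e ∈ uncovered M q d) : e < d := by
  induction d with
  | zero => simp [uncovered] at h
  | succ d ih =>
    simp only [uncovered] at h
    split_ifs at h with h'
    · have := ih h; omega
    · rcases Finset.mem_insert.1 h with rfl | h
      · omega
      · have := ih h; omega

theorem uncovered_filter {d e : ℕ} (h : d ≤ e) :
    (uncovered M q e).filter (· < d) = uncovered M q d := by
  induction e, h using Nat.le_induction with
  | base => exact Finset.filter_true_of_mem fun x hx => lt_of_mem_uncovered hx
  | succ e h ih =>
    rw [← ih]
    conv_lhs => rw [uncovered]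
    split_ifs with h'
    · rfl
    · rw [Finset.filter_insert, if_neg (by omega)]

theorem uncovered_filter_le {D d e : ℕ} (h : d < e) (he : e ≤ D) :
    (uncovered M q e).filter (· ≤ d) = (uncovered M q D).filter (· ≤ d) := by
  rw [← uncovered_filter he, Finset.filter_filter]
  refine Finset.filter_congr fun x _ => ?_
  omega

/-- This turns the recursion into a property of the final demand set: the history known on day `e`
is the final set cut off at `e`, because the recursion can only add day `d` at step `d`. -/
theorem mem_uncovered_iff {D d : ℕ} (h : d < D) : d ∈ uncovered M q D ↔
    ¬ ∃ e ∈ uncovered M q D, e < d ∧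
      e / M ^ q ((uncovered M q D).filter (· ≤ e)) e =
      d / M ^ q ((uncovered M q D).filter (· ≤ e)) e := by
  have h1 : d ∈ uncovered M q D ↔ d ∈ uncovered M q (d + 1) := by
    rw [← uncovered_filter (show d + 1 ≤ D from h)]
    simp
  have h2 : (∃ e ∈ uncovered M q D, e < d ∧
      e / M ^ q ((uncovered M q D).filter (· ≤ e)) e =
      d / M ^ q ((uncovered M q D).filter (· ≤ e)) e) ↔
      ∃ e ∈ uncovered M q d, e / M ^ q ((uncovered M q d).filter (· ≤ e)) e =
        d / M ^ q ((uncovered M q d).filter (· ≤ e)) e := by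
    constructor
    · rintro ⟨e, he, hed, heq⟩
      refine ⟨e, ?_, ?_⟩
      · rw [← uncovered_filter h.le]
        exact Finset.mem_filter.2 ⟨he, hed⟩
      · rwa [uncovered_filter_le hed h.le]
    · rintro ⟨e, he, heq⟩
      have hed := lt_of_mem_uncovered he
      rw [uncovered_filter_le hed h.le] at heq
      rw [← uncovered_filter h.le] at he
      exact ⟨e, (Finset.mem_filter.1 he).1, hed, heq⟩
  rw [h1, h2]
  have h3 : d ∉ uncovered M q d := fun h => (lt_of_mem_uncovered h).false
  simp only [uncovered]
  split_ifs with h'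
  · simp [h3, h']
  · simp [h']

end uncovered

theorem card_filter_div_eq {m : ℕ} (hm : 0 < m) (c N : ℕ) :
    ((Finset.range N).filter (· / m = c)).card ≤ m := by
  have : (Finset.range N).filter (· / m = c) ⊆ Finset.Ico (c * m) (c * m + m) := by
    intro x hx
    obtain ⟨-, rfl⟩ := Finset.mem_filter.1 hx
    have h1 := Nat.div_add_mod' x m
    have h2 := Nat.mod_lt x hm
    rw [Finset.mem_Ico]
    omega
  simpa using Finset.card_le_card this

theorem card_filter_div_eq_of_lt {m c N : ℕ} (hm : 0 < m) (h : (c + 1) * m ≤ N) :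
    m ≤ ((Finset.range N).filter (· / m = c)).card := by
  have : Finset.Ico (c * m) (c * m + m) ⊆ (Finset.range N).filter (· / m = c) := by
    intro x hx
    rw [Finset.mem_Ico] at hx
    rw [Finset.mem_filter, Finset.mem_range, Nat.div_eq_iff hm]
    rw [add_mul] at h
    refine ⟨?_, ?_, ?_⟩ <;> omega
  simpa using Finset.card_le_card this

/-- A family of days on which no permit can be shared, and every day up to the horizon is covered. -/
structure Greedy (M D : ℕ) (S : Finset ℕ) (q : ℕ → ℕ) : Prop where
  lt : ∀ d ∈ S, d < D
  fresh : ∀ d ∈ S, ∀ e ∈ S, e < d → e / M ^ q e ≠ d / M ^ q e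
  cover : ∀ d < D, ∃ e ∈ S, e ≤ d ∧ e / M ^ q e = d / M ^ q e

theorem greedy_uncovered (M D : ℕ) (q : Finset ℕ → ℕ → ℕ) :
    Greedy M D (uncovered M q D) (fun d => q ((uncovered M q D).filter (· ≤ d)) d) where
  lt d hd := lt_of_mem_uncovered hd
  fresh d hd e he hed heq :=
    (mem_uncovered_iff (lt_of_mem_uncovered hd)).1 hd ⟨e, he, hed, heq⟩
  cover d hd := by
    by_cases h : d ∈ uncovered M q D
    · exact ⟨d, h, le_rfl, rfl⟩
    · rw [mem_uncovered_iff hd, not_not] at h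
      obtain ⟨e, he, hed, heq⟩ := h
      exact ⟨e, he, hed.le, heq⟩

/-- By freshness, two demands never use the same interval at the same level, so each demand pays for
its permit in full. -/
theorem Greedy.permitCost_eq {M D K : ℕ} {w : ℕ → ℝ} {S : Finset ℕ} {q : ℕ → ℕ}
    (h : Greedy M D S q) (hq : ∀ d ∈ S, q d < K) :
    permitCost M w K S q = ∑ d ∈ S, w (q d) := by
  unfold permitCost
  rw [← Finset.sum_fiberwise_of_maps_to (t := Finset.range K) (g := q)
    (fun d hd => Finset.mem_range.2 (hq d hd))]
  refine Finset.sum_congr rfl fun j _ => ?_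
  rw [Finset.card_image_of_injOn, Finset.sum_congr rfl (g := fun _ => w j)]
  · simp [mul_comm]
  · intro d hd
    rw [(Finset.mem_filter.1 hd).2]
  · intro d hd e he hde
    obtain ⟨hd', hqd⟩ := Finset.mem_filter.1 (Finset.mem_coe.1 hd)
    obtain ⟨he', hqe⟩ := Finset.mem_filter.1 (Finset.mem_coe.1 he)
    dsimp only at hde
    rcases lt_trichotomy d e with hlt | hlt | hlt
    · exact absurd (by rw [hqd, hde]) (h.fresh e he' d hd' hlt)
    · exact hlt
    · exact absurd (by rw [hqe, hde]) (h.fresh d hd' e he' hlt)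

/-- Every interval of level `i` that contains a demand has caused enough cost. -/
theorem Greedy.le_sum_block {M K : ℕ} (hM : 0 < M) {w : ℕ → ℝ} (hw : ∀ j, 0 < w j)
    {r : ℝ} (hr : 0 < r)
    (hrate : ∀ i j, j < i → r * w i * (M : ℝ) ^ j ≤ w j * (M : ℝ) ^ i)
    {S : Finset ℕ} {q : ℕ → ℕ} (h : Greedy M (M ^ K) S q)
    {i c d : ℕ} (hi : i ≤ K) (hd : d ∈ S) (hdc : d / M ^ i = c) :
    w i ≤ ∑ e ∈ S.filter (· / M ^ i = c), if i ≤ q e then w i else w (q e) / r := by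
  have hnn : ∀ e, 0 ≤ (if i ≤ q e then w i else w (q e) / r) := by
    intro e
    split_ifs
    · exact (hw _).le
    · exact (div_pos (hw _) hr).le
  by_cases hex : ∃ e ∈ S.filter (· / M ^ i = c), i ≤ q e
  · obtain ⟨e, he, hie⟩ := hex
    have := Finset.single_le_sum (f := fun e => if i ≤ q e then w i else w (q e) / r)
      (fun e _ => hnn e) he
    simpa [hie] using this
  -- Only permits shorter than level `i` are bought in this interval. They cover all its `M ^ i`
  -- days, and per day they are at least `r` times as expensive as level `i`.
  · push Not at hex
    have hlt := h.lt d hd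
    have hblock : (c + 1) * M ^ i ≤ M ^ K := by
      have h1 : d / M ^ i < M ^ (K - i) := by
        rw [Nat.div_lt_iff_lt_mul (by positivity), ← pow_add]
        rwa [Nat.sub_add_cancel hi]
      calc (c + 1) * M ^ i ≤ M ^ (K - i) * M ^ i := by
            rw [← hdc]; exact Nat.mul_le_mul_right _ h1
        _ = M ^ K := by rw [← pow_add, Nat.sub_add_cancel hi]
    have hsub : (Finset.range (M ^ K)).filter (· / M ^ i = c) ⊆
        (S.filter (· / M ^ i = c)).biUnion fun e =>
          (Finset.range (M ^ K)).filter (· / M ^ q e = e / M ^ q e) := by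
      intro x hx
      obtain ⟨hxK, hxc⟩ := Finset.mem_filter.1 hx
      obtain ⟨e, he, hex', heq⟩ := h.cover x (Finset.mem_range.1 hxK)
      have hec : e / M ^ i = c := by
        rcases le_or_gt i (q e) with hie | hie
        · rcases lt_or_ge e d with hed | hed
          · refine absurd ?_ (h.fresh d hd e he hed)
            rw [heq]
            exact div_pow_eq_of_le hie (hxc.trans hdc.symm)
          · apply le_antisymm
            · rw [← hxc]; exact Nat.div_le_div_right hex'
            · rw [← hdc]; exact Nat.div_le_div_right hed
        · rw [← hxc]; exact div_pow_eq_of_le hie.le heq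
      exact Finset.mem_biUnion.2 ⟨e, Finset.mem_filter.2 ⟨he, hec⟩,
        Finset.mem_filter.2 ⟨hxK, heq.symm⟩⟩
    have hcard : M ^ i ≤ ∑ e ∈ S.filter (· / M ^ i = c), M ^ q e :=
      (card_filter_div_eq_of_lt (by positivity) hblock).trans <|
        (Finset.card_le_card hsub).trans <| Finset.card_biUnion_le.trans <|
        Finset.sum_le_sum fun e _ => card_filter_div_eq (by positivity) _ _
    have hMi : (0 : ℝ) < (M : ℝ) ^ i := by positivity
    have hcard' : (M : ℝ) ^ i ≤ ∑ e ∈ S.filter (· / M ^ i = c), (M : ℝ) ^ q e := by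
      exact_mod_cast hcard
    calc w i = (w i / (M : ℝ) ^ i) * (M : ℝ) ^ i := by field_simp
      _ ≤ (w i / (M : ℝ) ^ i) * ∑ e ∈ S.filter (· / M ^ i = c), (M : ℝ) ^ q e :=
          mul_le_mul_of_nonneg_left hcard' (div_pos (hw _) hMi).le
      _ = ∑ e ∈ S.filter (· / M ^ i = c), (w i / (M : ℝ) ^ i) * (M : ℝ) ^ q e :=
          Finset.mul_sum _ _ _
      _ ≤ _ := by
        refine Finset.sum_le_sum fun e he => ?_
        have hlt := hex e he
        rw [if_neg (by omega), le_div_iff₀ hr, div_mul_eq_mul_div, div_mul_eq_mul_div,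
          div_le_iff₀ hMi]
        have := hrate i (q e) hlt
        linarith

/-- Averaging over the `k` constant levels. A demand with permit of level `q e` is charged `w i` for
each `i ≤ q e`, in total at most `3 * w (q e)`, and `w (q e) / k` for each of the at most `k` higher
levels. -/
theorem Greedy.exists_level {M k : ℕ} (hM : 0 < M) (hk : 1 ≤ k) {w : ℕ → ℝ} (hw : ∀ j, 0 < w j)
    (hrate : ∀ i j, j < i → (k : ℝ) * w i * (M : ℝ) ^ j ≤ w j * (M : ℝ) ^ i)
    (hgeom : ∀ j, ∑ i ∈ Finset.range (j + 1), w i ≤ 3 * w j)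
    {S : Finset ℕ} {q : ℕ → ℕ} (h : Greedy M (M ^ (k - 1)) S q) (hq : ∀ d ∈ S, q d < k) :
    ∃ i < k, k * permitCost M w k S (fun _ => i) ≤ 4 * permitCost M w k S q := by
  have hk0 : (0 : ℝ) < k := by exact_mod_cast hk
  have hlevel : ∀ i ∈ Finset.range k, permitCost M w k S (fun _ => i) ≤
      ∑ e ∈ S, if i ≤ q e then w i else w (q e) / k := by
    intro i hi
    rw [Finset.mem_range] at hi
    rw [permitCost_const hi, ← Finset.sum_fiberwise_of_maps_to
      (t := S.image (· / M ^ i)) (g := (· / M ^ i)) (fun d hd => Finset.mem_image_of_mem _ hd),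
      mul_comm, ← nsmul_eq_mul]
    refine Finset.card_nsmul_le_sum _ _ _ fun c hc => ?_
    obtain ⟨d, hd, hdc⟩ := Finset.mem_image.1 hc
    exact h.le_sum_block hM hw hk0 hrate (by omega) hd hdc
  have hsum : ∑ i ∈ Finset.range k, permitCost M w k S (fun _ => i) ≤
      4 * permitCost M w k S q := by
    refine (Finset.sum_le_sum hlevel).trans ?_
    rw [Finset.sum_comm, h.permitCost_eq hq, Finset.mul_sum]
    refine Finset.sum_le_sum fun e he => ?_
    have hqe := hq e he
    rw [Finset.sum_ite]
    have h1 : ∑ i ∈ (Finset.range k).filter (· ≤ q e), w i ≤ 3 * w (q e) := by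
      refine le_trans (Finset.sum_le_sum_of_subset_of_nonneg ?_ fun i _ _ => (hw i).le) (hgeom _)
      intro i hi
      have := (Finset.mem_filter.1 hi).2
      exact Finset.mem_range.2 (by omega)
    have h2 : ∑ i ∈ (Finset.range k).filter (¬ · ≤ q e), w (q e) / k ≤ w (q e) := by
      rw [Finset.sum_const, nsmul_eq_mul]
      calc _ ≤ (k : ℝ) * (w (q e) / k) := by
            refine mul_le_mul_of_nonneg_right ?_ (div_pos (hw _) hk0).le
            exact_mod_cast (Finset.card_filter_le _ _).trans (Finset.card_range k).le
        _ = w (q e) := by field_simp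
    linarith
  by_contra! hcon
  have hne : (Finset.range k).Nonempty := ⟨0, Finset.mem_range.2 hk⟩
  have := Finset.sum_lt_sum_of_nonempty hne fun i hi => hcon i (Finset.mem_range.1 hi)
  rw [Finset.sum_const, Finset.card_range, nsmul_eq_mul] at this
  have h2 := mul_le_mul_of_nonneg_left hsum hk0.le
  rw [Finset.mul_sum] at h2
  linarith

/-! ### Random demands, described by their expectation operators. -/

/-- Given expectation operators `E c` for random demands in block `c`, the expectation over random
demands in at most `m` blocks `c, c + 1, …`, where after each block one stops with
probability `1 / 2`. -/
noncomputable def chainExpect (E : ℕ → (Finset ℕ → ℝ) → ℝ) :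
    ℕ → ℕ → (Finset ℕ → ℝ) → ℝ
  | 0, _, F => F ∅
  | m + 1, c, F => E c fun X =>
      1 / 2 * F X + 1 / 2 * chainExpect E m (c + 1) fun Y => F (X ∪ Y)

/-- The expectation over the random demands in the `c`-th interval of level `j`. -/
noncomputable def demandExpect (M : ℕ) : ℕ → ℕ → (Finset ℕ → ℝ) → ℝ
  | 0, c, F => F {c}
  | j + 1, c, F => chainExpect (demandExpect M j) M (c * M) F

section operators
variable {M : ℕ}

theorem chainExpect_add {E : ℕ → (Finset ℕ → ℝ) → ℝ}
    (hE : ∀ c F G, E c (fun X => F X + G X) = E c F + E c G) (m c : ℕ) (F G : Finset ℕ → ℝ) :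
    chainExpect E m c (fun X => F X + G X) = chainExpect E m c F + chainExpect E m c G := by
  induction m generalizing c F G with
  | zero => rfl
  | succ m ih =>
    simp only [chainExpect]
    rw [← hE]
    congr 1
    ext X
    rw [ih]
    ring

theorem demandExpect_add (j c : ℕ) (F G : Finset ℕ → ℝ) :
    demandExpect M j c (fun X => F X + G X) = demandExpect M j c F + demandExpect M j c G := by
  induction j generalizing c F G with
  | zero => rfl
  | succ j ih => exact chainExpect_add ih _ _ _ _

theorem chainExpect_mul {E : ℕ → (Finset ℕ → ℝ) → ℝ}
    (hE : ∀ c r F, E c (fun X => r * F X) = r * E c F) (m c : ℕ) (r : ℝ) (F : Finset ℕ → ℝ) :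
    chainExpect E m c (fun X => r * F X) = r * chainExpect E m c F := by
  induction m generalizing c F with
  | zero => rfl
  | succ m ih =>
    simp only [chainExpect]
    rw [← hE]
    congr 1
    ext X
    rw [ih]
    ring

theorem demandExpect_mul (j c : ℕ) (r : ℝ) (F : Finset ℕ → ℝ) :
    demandExpect M j c (fun X => r * F X) = r * demandExpect M j c F := by
  induction j generalizing c r F with
  | zero => rfl
  | succ j ih => exact chainExpect_mul (fun c r F => ih c r F) _ _ _ _

theorem chainExpect_const {E : ℕ → (Finset ℕ → ℝ) → ℝ}
    (hE : ∀ c r, E c (fun _ => r) = r) (m c : ℕ) (r : ℝ) :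
    chainExpect E m c (fun _ => r) = r := by
  induction m generalizing c with
  | zero => rfl
  | succ m ih =>
    simp only [chainExpect, ih]
    rw [← add_mul, hE]
    ring

theorem demandExpect_const (j c : ℕ) (r : ℝ) : demandExpect M j c (fun _ => r) = r := by
  induction j generalizing c r with
  | zero => rfl
  | succ j ih => exact chainExpect_const ih _ _ _

/-- The comparison is required only on sets that can occur: nonempty ones inside the right blocks.
This is how the support of the distribution enters all later estimates. -/
theorem chainExpect_mono {E : ℕ → (Finset ℕ → ℝ) → ℝ} {b : ℕ}
    (hE : ∀ c F G, (∀ X : Finset ℕ, X.Nonempty → (∀ d ∈ X, d / b = c) → F X ≤ G X) →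
      E c F ≤ E c G) (m c : ℕ) (F G : Finset ℕ → ℝ)
    (h : ∀ X : Finset ℕ, (0 < m → X.Nonempty) → (∀ d ∈ X, c ≤ d / b ∧ d / b < c + m) → F X ≤ G X) :
    chainExpect E m c F ≤ chainExpect E m c G := by
  induction m generalizing c F G with
  | zero => exact h _ (by simp) (by simp)
  | succ m ih =>
    simp only [chainExpect]
    refine hE _ _ _ fun X hX hXc => ?_
    have h1 : F X ≤ G X := by
      refine h _ (fun _ => hX) fun d hd => ?_
      have := hXc d hd
      omega
    have h2 : chainExpect E m (c + 1) (fun Y => F (X ∪ Y)) ≤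
        chainExpect E m (c + 1) (fun Y => G (X ∪ Y)) := by
      refine ih _ _ _ fun Y _ hY => h _ (fun _ => hX.mono Finset.subset_union_left) fun d hd => ?_
      rcases Finset.mem_union.1 hd with hd | hd
      · have := hXc d hd
        omega
      · have := hY d hd
        omega
    linarith

theorem div_pow_succ (M d j : ℕ) : d / M ^ (j + 1) = d / M ^ j / M := by
  rw [pow_succ, Nat.div_div_eq_div_mul]

theorem demandExpect_mono (hM : 0 < M) (j c : ℕ) (F G : Finset ℕ → ℝ)
    (h : ∀ X : Finset ℕ, X.Nonempty → (∀ d ∈ X, d / M ^ j = c) → F X ≤ G X) :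
    demandExpect M j c F ≤ demandExpect M j c G := by
  induction j generalizing c F G with
  | zero => exact h _ (by simp) (by simp)
  | succ j ih =>
    refine chainExpect_mono ih _ _ _ _ fun X hX hXc => h _ (hX hM) fun d hd => ?_
    have := hXc d hd
    rw [div_pow_succ, Nat.div_eq_iff hM]
    omega

/-- The operator is a finite convex combination, so it commutes with the average over a randomized
algorithm. This is the exchange behind Yao's principle. -/
theorem chainExpect_integral {Ω : Type*} [MeasurableSpace Ω] {μ : Measure Ω}
    {E : ℕ → (Finset ℕ → ℝ) → ℝ}
    (hE : ∀ c (f : Ω → Finset ℕ → ℝ), (∀ X, Integrable (f · X) μ) →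
      Integrable (fun a => E c (f a)) μ ∧ E c (fun X => ∫ a, f a X ∂μ) = ∫ a, E c (f a) ∂μ)
    (m c : ℕ) (f : Ω → Finset ℕ → ℝ) (hf : ∀ X, Integrable (f · X) μ) :
    Integrable (fun a => chainExpect E m c (f a)) μ ∧
      chainExpect E m c (fun X => ∫ a, f a X ∂μ) = ∫ a, chainExpect E m c (f a) ∂μ := by
  induction m generalizing c f with
  | zero => exact ⟨hf ∅, rfl⟩
  | succ m ih =>
    simp only [chainExpect]
    have h1 := fun X : Finset ℕ => ih (c + 1) (fun a Y => f a (X ∪ Y)) (fun Y => hf _)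
    have h2 := hE c (fun a X => 1 / 2 * f a X + 1 / 2 * chainExpect E m (c + 1)
      fun Y => f a (X ∪ Y)) (fun X => ((hf X).const_mul _).add ((h1 X).1.const_mul _))
    refine ⟨h2.1, ?_⟩
    rw [← h2.2]
    congr 1
    ext X
    rw [integral_add ((hf X).const_mul _) ((h1 X).1.const_mul _), integral_const_mul,
      integral_const_mul, (h1 X).2]

theorem demandExpect_integral {Ω : Type*} [MeasurableSpace Ω] {μ : Measure Ω}
    (j c : ℕ) (f : Ω → Finset ℕ → ℝ) (hf : ∀ X, Integrable (f · X) μ) :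
    Integrable (fun a => demandExpect M j c (f a)) μ ∧
      demandExpect M j c (fun X => ∫ a, f a X ∂μ) = ∫ a, demandExpect M j c (f a) ∂μ := by
  induction j generalizing c f with
  | zero => exact ⟨hf _, rfl⟩
  | succ j ih => exact chainExpect_integral ih _ _ _ hf

end operators

/-- The expected number of blocks in `chainExpect`. -/
noncomputable def meanBlocks : ℕ → ℝ
  | 0 => 0
  | m + 1 => 1 + 1 / 2 * meanBlocks m

theorem meanBlocks_eq (m : ℕ) : meanBlocks m = 2 - 2 * (1 / 2) ^ m := by
  induction m with
  | zero => norm_num [meanBlocks]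
  | succ m ih => rw [meanBlocks, ih]; ring

theorem meanBlocks_mono : Monotone meanBlocks := by
  intro a b h
  rw [meanBlocks_eq, meanBlocks_eq]
  have := pow_le_pow_of_le_one (by norm_num : (0 : ℝ) ≤ 1 / 2) (by norm_num) h
  linarith

theorem meanBlocks_nonneg (m : ℕ) : 0 ≤ meanBlocks m := meanBlocks_mono (Nat.zero_le m)

theorem meanBlocks_le_two (m : ℕ) : meanBlocks m ≤ 2 := by
  rw [meanBlocks_eq]
  have : (0 : ℝ) ≤ (1 / 2) ^ m := by positivity
  linarith

/-- As in Wald's identity: the expected number of blocks times a bound for the expected number of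
demands per block. -/
theorem chainExpect_card {E : ℕ → (Finset ℕ → ℝ) → ℝ} {b : ℕ} {y : ℝ}
    (hadd : ∀ c F G, E c (fun X => F X + G X) = E c F + E c G)
    (hconst : ∀ c r, E c (fun _ => r) = r)
    (hE : ∀ c F G, (∀ X : Finset ℕ, X.Nonempty → (∀ d ∈ X, d / b = c) → F X ≤ G X) →
      E c F ≤ E c G)
    (hy : ∀ c, E c (fun X => (X.card : ℝ)) ≤ y) (m c : ℕ) :
    chainExpect E m c (fun X => (X.card : ℝ)) ≤ meanBlocks m * y := by
  induction m generalizing c with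
  | zero => simp [chainExpect, meanBlocks]
  | succ m ih =>
    have h1 : ∀ X : Finset ℕ, chainExpect E m (c + 1) (fun Y => ((X ∪ Y).card : ℝ)) ≤
        X.card + meanBlocks m * y := by
      intro X
      calc _ ≤ chainExpect E m (c + 1) (fun Y => (X.card : ℝ) + Y.card) :=
            chainExpect_mono hE _ _ _ _ fun Y _ _ => by exact_mod_cast Finset.card_union_le X Y
        _ = X.card + chainExpect E m (c + 1) (fun Y => (Y.card : ℝ)) := by
            rw [chainExpect_add hadd, chainExpect_const hconst]
        _ ≤ _ := by linarith [ih (c + 1)]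
    calc _ ≤ E c (fun X => (X.card : ℝ) + 1 / 2 * (meanBlocks m * y)) :=
          hE _ _ _ fun X _ _ => by linarith [h1 X]
      _ = E c (fun X => (X.card : ℝ)) + 1 / 2 * (meanBlocks m * y) := by rw [hadd, hconst]
      _ ≤ _ := by
        rw [meanBlocks]
        linarith [hy c]

theorem demandExpect_card {M : ℕ} (hM : 0 < M) (j c : ℕ) :
    demandExpect M j c (fun X => (X.card : ℝ)) ≤ meanBlocks M ^ j := by
  induction j generalizing c with
  | zero => simp [demandExpect]
  | succ j ih =>
    rw [pow_succ']
    exact chainExpect_card (demandExpect_add j) (demandExpect_const j)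
      (demandExpect_mono hM j) ih _ _

/-! ### The expected offline optimum under random demands. -/

section optimum
variable {M : ℕ}

/-- The optimal cost of permits of levels up to `j` for the demands in the `c`-th interval of
level `j`. -/
noncomputable def blockOpt (M : ℕ) (w : ℕ → ℝ) : ℕ → ℕ → Finset ℕ → ℝ
  | 0, c, S => if c ∈ S then w 0 else 0
  | j + 1, c, S => min (w (j + 1)) (∑ i ∈ Finset.range M, blockOpt M w j (c * M + i) S)

theorem blockOpt_congr (hM : 0 < M) {w : ℕ → ℝ} {j c : ℕ} {S T : Finset ℕ}
    (h : ∀ d, d / M ^ j = c → (d ∈ S ↔ d ∈ T)) : blockOpt M w j c S = blockOpt M w j c T := by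
  induction j generalizing c with
  | zero => simp [blockOpt, h c (by simp)]
  | succ j ih =>
    rw [blockOpt, blockOpt]
    congr 1
    refine Finset.sum_congr rfl fun i hi => ih fun d hd => h d ?_
    rw [Finset.mem_range] at hi
    rw [div_pow_succ, hd, Nat.div_eq_iff hM]
    omega

theorem blockOpt_of_disjoint {w : ℕ → ℝ} (hw : ∀ j, 0 ≤ w j) (hM : 0 < M) {j c : ℕ}
    {S : Finset ℕ} (h : ∀ d ∈ S, d / M ^ j ≠ c) : blockOpt M w j c S = 0 := by
  have h0 : ∀ j c, blockOpt M w j c ∅ = 0 := by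
    intro j
    induction j with
    | zero => intro c; simp [blockOpt]
    | succ j ih => intro c; simp [blockOpt, ih, hw]
  rw [blockOpt_congr hM (T := ∅), h0]
  intro d hd
  simp only [Finset.notMem_empty, iff_false]
  exact fun hdS => h d hdS hd

/-- The permit cost incurred at levels `i ≤ j` in the `c`-th interval of level `j`. -/
noncomputable def blockCost (M : ℕ) (w : ℕ → ℝ) (j c : ℕ) (S : Finset ℕ) (q : ℕ → ℕ) : ℝ :=
  permitCost M w (j + 1) (S.filter (· / M ^ j = c)) q

theorem permitCost_biUnion_le {K : ℕ} {w : ℕ → ℝ} (hw : ∀ j, 0 ≤ w j) {ι : Type*} [DecidableEq ι]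
    (s : Finset ι) (S : ι → Finset ℕ) (q : ℕ → ℕ) :
    permitCost M w K (s.biUnion S) q ≤ ∑ i ∈ s, permitCost M w K (S i) q := by
  unfold permitCost
  rw [Finset.sum_comm]
  refine Finset.sum_le_sum fun j _ => ?_
  rw [← Finset.mul_sum]
  refine mul_le_mul_of_nonneg_left ?_ (hw j)
  rw [Finset.filter_biUnion, Finset.biUnion_image]
  exact_mod_cast Finset.card_biUnion_le

theorem permitCost_congr {K : ℕ} {w : ℕ → ℝ} {S : Finset ℕ} {q q' : ℕ → ℕ}
    (h : ∀ d ∈ S, q d = q' d) : permitCost M w K S q = permitCost M w K S q' := by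
  unfold permitCost
  refine Finset.sum_congr rfl fun j _ => ?_
  rw [Finset.filter_congr fun d hd => by rw [h d hd]]

/-- The assignment follows the recursion of `blockOpt`: take the long permit if it attains the
minimum, otherwise glue the assignments of the sub-intervals. -/
theorem exists_blockCost_le {w : ℕ → ℝ} (hw : ∀ j, 0 ≤ w j) (hM : 0 < M) (S : Finset ℕ)
    (j c : ℕ) :
    ∃ g : ℕ → ℕ, (∀ d, g d ≤ j) ∧ blockCost M w j c S g ≤ blockOpt M w j c S := by
  induction j generalizing c with
  | zero =>
    refine ⟨fun _ => 0, fun _ => le_rfl, ?_⟩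
    rw [blockCost, permitCost_const (by omega)]
    by_cases h : c ∈ S <;> simp [blockOpt, h, Finset.filter_eq']
  | succ j ih =>
    choose g hg hgc using ih
    rcases le_total (w (j + 1)) (∑ i ∈ Finset.range M, blockOpt M w j (c * M + i) S) with h | h
    · refine ⟨fun _ => j + 1, fun _ => le_rfl, ?_⟩
      rw [blockCost, permitCost_const (by omega), blockOpt, min_eq_left h]
      have : (((S.filter (· / M ^ (j + 1) = c)).image (· / M ^ (j + 1))).card : ℝ) ≤ 1 := by
        have : ((S.filter (· / M ^ (j + 1) = c)).image (· / M ^ (j + 1))) ⊆ {c} := by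
          intro x hx
          obtain ⟨d, hd, rfl⟩ := Finset.mem_image.1 hx
          simpa using (Finset.mem_filter.1 hd).2
        exact_mod_cast Finset.card_le_card this
      nlinarith [hw (j + 1)]
    · refine ⟨fun d => g (d / M ^ j) d, fun d => (hg _ _).trans (Nat.le_succ _), ?_⟩
      rw [blockOpt, min_eq_right h, blockCost]
      have hset : S.filter (· / M ^ (j + 1) = c) =
          (Finset.range M).biUnion fun i => S.filter (· / M ^ j = c * M + i) := by
        ext d
        simp only [Finset.mem_filter, Finset.mem_biUnion, Finset.mem_range]
        rw [div_pow_succ, Nat.div_eq_iff hM]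
        constructor
        · rintro ⟨h1, h2, h3⟩
          exact ⟨d / M ^ j - c * M, by omega, h1, by omega⟩
        · rintro ⟨i, hi, h1, h2⟩
          exact ⟨h1, by omega, by omega⟩
      rw [hset]
      refine (permitCost_biUnion_le hw _ _ _).trans (Finset.sum_le_sum fun i _ => ?_)
      refine le_trans (le_of_eq ?_) (hgc (c * M + i))
      rw [blockCost, permitCost_congr (q' := g (c * M + i)), permitCost, Finset.sum_range_succ]
      · rw [permitCost]
        have : (S.filter (· / M ^ j = c * M + i)).filter (g (c * M + i) · = j + 1) = ∅ := by
          refine Finset.filter_eq_empty_iff.2 fun d _ => ?_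
          have := hg (c * M + i) d
          omega
        simp [this]
      · intro d hd
        rw [(Finset.mem_filter.1 hd).2]

/-- An upper bound for the expected optimum when the blocks have expected optimum at most `u`. -/
noncomputable def cappedMean (W u : ℝ) : ℕ → ℝ → ℝ
  | 0, s => min W s
  | m + 1, s => 1 / 2 * min W (s + u) + 1 / 2 * cappedMean W u m (s + u)

theorem cappedMean_le_left (W u : ℝ) (m : ℕ) (s : ℝ) : cappedMean W u m s ≤ W := by
  induction m generalizing s with
  | zero => exact min_le_left _ _
  | succ m ih =>
    rw [cappedMean]
    linarith [ih (s + u), min_le_left W (s + u)]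

/-- Without the cap the mean is `s + u * meanBlocks m`. With probability `(1 / 2) ^ g` the process
survives `g` blocks; the uncapped sum is then at least `2 * W`, so the cap saves at least `W`. -/
theorem cappedMean_le_sub {W u : ℝ} (hu : 0 ≤ u) {g m : ℕ} (hg : g ≤ m) {s : ℝ}
    (h : 2 * W ≤ s + g * u) :
    cappedMean W u m s ≤ s + u * meanBlocks m - (1 / 2) ^ g * W := by
  induction g generalizing m s with
  | zero =>
    have h1 := cappedMean_le_left W u m s
    have h2 := mul_nonneg hu (meanBlocks_nonneg m)
    simp only [Nat.cast_zero, zero_mul, add_zero] at h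
    linarith
  | succ g ih =>
    obtain ⟨m, rfl⟩ : ∃ m', m = m' + 1 := ⟨m - 1, by omega⟩
    have h1 := ih (m := m) (s := s + u) (by omega) (by push_cast at h; linarith)
    have h2 := min_le_right W (s + u)
    rw [cappedMean, meanBlocks, pow_succ]
    linarith

/-- Jensen's inequality for the function `cappedMean`, which is built from concave functions `min W
(s + ·)`. -/
theorem demandExpect_cappedMean_le (hM : 0 < M) (W u : ℝ) (m j c : ℕ) (s : ℝ) (V : Finset ℕ → ℝ)
    (hV : demandExpect M j c V ≤ u) :
    demandExpect M j c (fun X => cappedMean W u m (s + V X)) ≤ cappedMean W u m (s + u) := by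
  have hmin : ∀ s, demandExpect M j c (fun X => min W (s + V X)) ≤ min W (s + u) := by
    intro s
    refine le_min ?_ ?_
    · calc _ ≤ demandExpect M j c (fun _ => W) :=
            demandExpect_mono hM _ _ _ _ fun X _ _ => min_le_left _ _
        _ = W := demandExpect_const _ _ _
    · calc _ ≤ demandExpect M j c (fun X => s + V X) :=
            demandExpect_mono hM _ _ _ _ fun X _ _ => min_le_right _ _
        _ = s + demandExpect M j c V := by rw [demandExpect_add, demandExpect_const]
        _ ≤ _ := by linarith
  induction m generalizing s with
  | zero => exact hmin s
  | succ m ih =>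
    simp only [cappedMean]
    rw [demandExpect_add, demandExpect_mul, demandExpect_mul]
    have h1 := hmin (s + u)
    have h2 := ih (s + u)
    have e : ∀ X, s + V X + u = s + u + V X := fun X => by ring
    simp only [e]
    linarith

/-- Blocks are revealed one at a time, with `s` holding the optimum accumulated so far. Jensen's
inequality replaces the optimum of each block by the bound `u` for its mean. -/
theorem chainExpect_blockOpt_le (hM : 0 < M) {w : ℕ → ℝ} (hw : ∀ j, 0 ≤ w j) {j : ℕ} {u : ℝ}
    (hu : ∀ c, demandExpect M j c (blockOpt M w j c) ≤ u) (W : ℝ) (m c : ℕ) (s : ℝ) :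
    chainExpect (demandExpect M j) m c
      (fun X => min W (s + ∑ i ∈ Finset.range m, blockOpt M w j (c + i) X)) ≤
      cappedMean W u m s := by
  induction m generalizing c s with
  | zero => simp [chainExpect, cappedMean]
  | succ m ih =>
    have hu' : demandExpect M j c (fun X => 1 / 2 * min W (s + blockOpt M w j c X) +
        1 / 2 * cappedMean W u m (s + blockOpt M w j c X)) ≤ cappedMean W u (m + 1) s := by
      rw [demandExpect_add, demandExpect_mul, demandExpect_mul, cappedMean]
      have h1 := demandExpect_cappedMean_le hM W u m j c s _ (hu c)
      have h2 := demandExpect_cappedMean_le hM W u 0 j c s _ (hu c)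
      simp only [cappedMean] at h2
      linarith
    refine le_trans (demandExpect_mono hM _ _ _ _ fun X _ hX => ?_) hu'
    have h1 : ∑ i ∈ Finset.range (m + 1), blockOpt M w j (c + i) X = blockOpt M w j c X := by
      rw [Finset.sum_range_succ', Finset.sum_eq_zero]
      · simp
      · intro i _
        exact blockOpt_of_disjoint hw hM fun d hd => by rw [hX d hd]; omega
    beta_reduce
    rw [h1]
    have h2 := ih (c + 1) (s + blockOpt M w j c X)
    have h3 : chainExpect (demandExpect M j) m (c + 1)
        (fun Y => min W (s + ∑ i ∈ Finset.range (m + 1), blockOpt M w j (c + i) (X ∪ Y))) ≤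
        chainExpect (demandExpect M j) m (c + 1) (fun Y => min W (s + blockOpt M w j c X +
          ∑ i ∈ Finset.range m, blockOpt M w j (c + 1 + i) Y)) := by
      refine chainExpect_mono (demandExpect_mono hM j) _ _ _ _ fun Y _ hY => ?_
      refine le_of_eq ?_
      congr 1
      rw [Finset.sum_range_succ', add_assoc s, add_comm (blockOpt M w j c X)]
      congr 2
      · refine Finset.sum_congr rfl fun i _ => ?_
        rw [show c + (i + 1) = c + 1 + i by ring]
        refine blockOpt_congr hM fun d hd => ?_
        rw [Finset.mem_union, or_iff_right]
        intro hdX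
        have := hX d hdX
        omega
      · refine blockOpt_congr hM fun d hd => ?_
        rw [Finset.mem_union, or_iff_left]
        intro hdY
        have := hY d hdY
        omega
    linarith

/-- With `K` levels of geometrically growing permits, the expected optimum is a
`O(1 / log K)`-fraction of the weight of the most expensive permit. -/
theorem demandExpect_blockOpt_le (hM : 0 < M) {w : ℕ → ℝ} (hw : ∀ j, 0 < w j)
    (hsucc : ∀ j, w (j + 1) = meanBlocks M * w j) {g : ℕ} (hg : 0 < g) (hgM : g ≤ M) (j c : ℕ) :
    demandExpect M j c (blockOpt M w j c) ≤ max (4 / g : ℝ) (1 - j * (1 / 2) ^ g) * w j := by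
  induction j generalizing c with
  | zero =>
    have h1 : (1 : ℝ) ≤ max (4 / g : ℝ) (1 - (0 : ℕ) * (1 / 2) ^ g) := by simp
    have := hw 0
    simp only [demandExpect, blockOpt, Finset.mem_singleton, if_true]
    nlinarith
  | succ j ih =>
    set x : ℝ := max (4 / g : ℝ) (1 - j * (1 / 2) ^ g) with hx
    have hg0 : (0 : ℝ) < g := by exact_mod_cast hg
    have hxg : 4 ≤ g * x := by
      have : 4 / (g : ℝ) ≤ x := le_max_left _ _
      rw [div_le_iff₀ hg0] at this
      linarith
    have hx0 : 0 ≤ x := le_trans (by positivity) (le_max_left _ _)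
    have h1 := chainExpect_blockOpt_le hM (fun j => (hw j).le) ih (w (j + 1)) M (c * M) 0
    simp only [zero_add] at h1
    refine h1.trans ?_
    -- Survival of `g` blocks suffices: `g * x ≥ 4` and `w (j + 1) ≤ 2 * w j` give `g * (x * w j) ≥
    -- 2 * w (j + 1)`.
    have h2 := cappedMean_le_sub (W := w (j + 1)) (mul_nonneg hx0 (hw j).le) hgM (s := 0) (by
      have h3 := mul_le_mul_of_nonneg_right hxg (hw j).le
      have h4 := mul_le_mul_of_nonneg_right (meanBlocks_le_two M) (hw j).le
      rw [hsucc]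
      linarith)
    refine h2.trans ?_
    have h5 : x * w j * meanBlocks M = x * w (j + 1) := by rw [hsucc]; ring
    rw [h5, zero_add, ← sub_mul]
    refine mul_le_mul_of_nonneg_right ?_ (hw _).le
    rcases max_cases (4 / g : ℝ) (1 - j * (1 / 2) ^ g) with ⟨h6, -⟩ | ⟨h6, -⟩
    · refine le_trans ?_ (le_max_left _ _)
      have : (0 : ℝ) ≤ (1 / 2) ^ g := by positivity
      rw [hx, h6]
      linarith
    · refine le_trans ?_ (le_max_right _ _)
      rw [hx, h6]
      push_cast
      linarith

end optimum

/-! ### The lower bound for online strategies under random demands. -/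

section online
variable {M : ℕ}

theorem le_permitCost_union {w : ℕ → ℝ} (hw : ∀ j, 0 ≤ w j) {j : ℕ} {X Y : Finset ℕ}
    (h : ∀ d ∈ X, ∀ e ∈ Y, d / M ^ j ≠ e / M ^ j) (q : ℕ → ℕ) :
    permitCost M w (j + 1) X q + permitCost M w (j + 1) Y q ≤ permitCost M w (j + 1) (X ∪ Y) q := by
  unfold permitCost
  rw [← Finset.sum_add_distrib]
  refine Finset.sum_le_sum fun i hi => ?_
  rw [← mul_add]
  refine mul_le_mul_of_nonneg_left ?_ (hw i)
  rw [Finset.filter_union, Finset.image_union, Finset.card_union_of_disjoint]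
  · push_cast; rfl
  · rw [Finset.disjoint_left]
    intro x hx hy
    obtain ⟨d, hd, rfl⟩ := Finset.mem_image.1 hx
    obtain ⟨e, he, hde⟩ := Finset.mem_image.1 hy
    rw [Finset.mem_range] at hi
    exact h d (Finset.mem_filter.1 hd).1 e (Finset.mem_filter.1 he).1
      (div_pow_eq_of_le (by omega) hde.symm)

theorem permitCost_nonneg {w : ℕ → ℝ} (hw : ∀ j, 0 ≤ w j) (K : ℕ) (S : Finset ℕ) (q : ℕ → ℕ) :
    0 ≤ permitCost M w K S q :=
  Finset.sum_nonneg fun j _ => mul_nonneg (hw j) (Nat.cast_nonneg _)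

open Classical in
/-- The cost caused by the demands `X`, after the demands `H`, when the online strategy `r` is
charged `w j` only once for all permits of level at least `j`. -/
noncomputable def onlineCost (M : ℕ) (w : ℕ → ℝ) (r : Finset ℕ → ℕ → ℕ) (j : ℕ)
    (H X : Finset ℕ) : ℝ :=
  permitCost M w j X (r (H ∪ X)) + if ∃ d ∈ X, j ≤ r (H ∪ X) d then w j else 0

variable {w : ℕ → ℝ} {r : Finset ℕ → ℕ → ℕ}

theorem onlineCost_nonneg (hw : ∀ j, 0 ≤ w j) (j : ℕ) (H X : Finset ℕ) :
    0 ≤ onlineCost M w r j H X := by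
  unfold onlineCost
  refine add_nonneg (permitCost_nonneg hw _ _ _) ?_
  split_ifs <;> simp [hw]

theorem onlineCost_le_add (hw : ∀ j, 0 ≤ w j) (j : ℕ) (H X : Finset ℕ) :
    onlineCost M w r j H X ≤ permitCost M w (j + 1) X (r (H ∪ X)) + w j := by
  unfold onlineCost
  have h1 : permitCost M w j X (r (H ∪ X)) ≤ permitCost M w (j + 1) X (r (H ∪ X)) := by
    unfold permitCost
    rw [Finset.sum_range_succ]
    exact le_add_of_nonneg_right (mul_nonneg (hw j) (Nat.cast_nonneg _))
  have h2 : (if ∃ d ∈ X, j ≤ r (H ∪ X) d then w j else 0) ≤ w j := by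
    split_ifs
    · exact le_rfl
    · exact hw j
  linarith

theorem onlineCost_le (hw : ∀ j, 0 ≤ w j) {j : ℕ} {H X : Finset ℕ}
    (h : ∀ d ∈ X, r (H ∪ X) d < j + 1) :
    onlineCost M w r j H X ≤ permitCost M w (j + 1) X (r (H ∪ X)) := by
  unfold onlineCost
  unfold permitCost
  rw [Finset.sum_range_succ]
  gcongr
  split_ifs with h'
  · obtain ⟨d, hd, hjd⟩ := h'
    have hd' : r (H ∪ X) d = j := by have := h d hd; omega
    have : 0 < ((X.filter (r (H ∪ X) · = j)).image (· / M ^ j)).card :=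
      Finset.card_pos.2 ⟨_, Finset.mem_image_of_mem _ (Finset.mem_filter.2 ⟨hd, hd'⟩)⟩
    have : (1 : ℝ) ≤ ((X.filter (r (H ∪ X) · = j)).image (· / M ^ j)).card := by
      exact_mod_cast this
    nlinarith [hw j]
  · exact mul_nonneg (hw j) (Nat.cast_nonneg _)

/-- Before each block, the expected cost of going on with short permits is at most the price of the
long one, so an online strategy gains nothing from the long permit. The history `H` is arbitrary
because the strategy may depend on it. -/
theorem le_chainExpect_onlineCost (hM : 0 < M) (hw : ∀ j, 0 ≤ w j)
    (hsucc : ∀ j, w (j + 1) = meanBlocks M * w j)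
    (hr : ∀ S T d, S.filter (· ≤ d) = T.filter (· ≤ d) → r S d = r T d) {j : ℕ}
    (hE : ∀ c H, (∀ d ∈ H, d / M ^ j < c) → w j ≤ demandExpect M j c (onlineCost M w r j H))
    {m : ℕ} (hm : m ≤ M) (c : ℕ) (H : Finset ℕ) (hH : ∀ d ∈ H, d / M ^ j < c) :
    meanBlocks m * w j ≤ chainExpect (demandExpect M j) m c (onlineCost M w r (j + 1) H) := by
  induction m generalizing c H with
  | zero => simpa [chainExpect, meanBlocks] using onlineCost_nonneg hw _ _ _
  | succ m ih =>
    -- The long permit costs at least this block plus the expected rest, which is reached with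
    -- probability 1/2.
    have hcap : w j + 1 / 2 * (meanBlocks m * w j) ≤ w (j + 1) := by
      rw [hsucc]
      have := mul_le_mul_of_nonneg_right (meanBlocks_mono hm) (hw j)
      rw [meanBlocks] at this
      linarith
    suffices h : demandExpect M j c (fun X => onlineCost M w r j H X +
        1 / 2 * (meanBlocks m * w j)) ≤
        chainExpect (demandExpect M j) (m + 1) c (onlineCost M w r (j + 1) H) by
      refine le_trans ?_ h
      rw [demandExpect_add, demandExpect_const, meanBlocks]
      linarith [hE c H hH]
    refine demandExpect_mono hM _ _ _ _ fun X _ hX => ?_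
    have hHX : ∀ d ∈ H ∪ X, d / M ^ j < c + 1 := by
      intro d hd
      rcases Finset.mem_union.1 hd with hd | hd
      · have := hH d hd; omega
      · have := hX d hd; omega
    -- If a long permit is bought in this block, its price pays for the block and the rest, and all
    -- later costs are dropped. Otherwise the block pays for itself and induction handles the rest.
    by_cases hev : ∃ d ∈ X, j + 1 ≤ r (H ∪ X) d
    · have h1 : permitCost M w (j + 1) X (r (H ∪ X)) + w (j + 1) ≤
          onlineCost M w r (j + 1) H X := by
        rw [onlineCost, if_pos hev]
      have h2 : permitCost M w (j + 1) X (r (H ∪ X)) + w (j + 1) ≤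
          chainExpect (demandExpect M j) m (c + 1) (fun Y => onlineCost M w r (j + 1) H (X ∪ Y)) := by
        rw [← chainExpect_const (E := demandExpect M j) (demandExpect_const j) m (c + 1)
          (permitCost M w (j + 1) X (r (H ∪ X)) + w (j + 1))]
        refine chainExpect_mono (demandExpect_mono hM j) _ _ _ _ fun Y _ hY => ?_
        -- The blocks of `Y` lie after those of `X`, so later demands do not change the decisions on
        -- `X`.
        have hagree : ∀ d ∈ X, r (H ∪ X) d = r (H ∪ (X ∪ Y)) d := by
          intro d hd
          refine hr _ _ _ ?_
          ext x
          simp only [Finset.mem_filter, Finset.mem_union]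
          have : x ∈ Y → ¬ x ≤ d := by
            intro hx hxd
            have h3 := hY x hx
            have h4 := hX d hd
            have := Nat.div_le_div_right (c := M ^ j) hxd
            omega
          tauto
        obtain ⟨d, hd, hjd⟩ := hev
        have hev' : ∃ d ∈ X ∪ Y, j + 1 ≤ r (H ∪ (X ∪ Y)) d :=
          ⟨d, Finset.mem_union_left _ hd, by rw [← hagree d hd]; exact hjd⟩
        rw [onlineCost, if_pos hev']
        have h3 := le_permitCost_union (M := M) hw (j := j) (X := X) (Y := Y) (by
          intro d hd e he
          have := hX d hd
          have := hY e he
          omega) (r (H ∪ (X ∪ Y)))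
        have h4 := permitCost_nonneg (M := M) hw (j + 1) Y (r (H ∪ (X ∪ Y)))
        rw [permitCost_congr hagree]
        linarith
      have h3 := onlineCost_le_add (M := M) (r := r) hw j H X
      linarith
    · have h1 : permitCost M w (j + 1) X (r (H ∪ X)) ≤ onlineCost M w r (j + 1) H X := by
        rw [onlineCost, if_neg hev, add_zero]
      have h2 : permitCost M w (j + 1) X (r (H ∪ X)) + meanBlocks m * w j ≤
          chainExpect (demandExpect M j) m (c + 1) (fun Y => onlineCost M w r (j + 1) H (X ∪ Y)) := by
        have h3 := ih (by omega) (c + 1) (H ∪ X) hHX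
        calc _ ≤ permitCost M w (j + 1) X (r (H ∪ X)) + chainExpect (demandExpect M j) m (c + 1)
              (onlineCost M w r (j + 1) (H ∪ X)) := by linarith
          _ = chainExpect (demandExpect M j) m (c + 1) (fun Y =>
              permitCost M w (j + 1) X (r (H ∪ X)) + onlineCost M w r (j + 1) (H ∪ X) Y) := by
            rw [chainExpect_add (demandExpect_add j), chainExpect_const (demandExpect_const j)]
          _ ≤ _ := by
            refine chainExpect_mono (demandExpect_mono hM j) _ _ _ _ fun Y _ hY => ?_
            have hagree : ∀ d ∈ X, r (H ∪ X) d = r (H ∪ (X ∪ Y)) d := by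
              intro d hd
              refine hr _ _ _ ?_
              ext x
              simp only [Finset.mem_filter, Finset.mem_union]
              have : x ∈ Y → ¬ x ≤ d := by
                intro hx hxd
                have h3 := hY x hx
                have h4 := hX d hd
                have := Nat.div_le_div_right (c := M ^ j) hxd
                omega
              tauto
            have h5 := le_permitCost_union (M := M) hw (j := j) (X := X) (Y := Y) (by
              intro d hd e he
              have := hX d hd
              have := hY e he
              omega) (r (H ∪ (X ∪ Y)))
            have h6 : (if ∃ d ∈ Y, j + 1 ≤ r (H ∪ X ∪ Y) d then w (j + 1) else 0) ≤
                if ∃ d ∈ X ∪ Y, j + 1 ≤ r (H ∪ (X ∪ Y)) d then w (j + 1) else 0 := by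
              split_ifs with ha hb hb
              · exact le_rfl
              · obtain ⟨d, hd, hjd⟩ := ha
                exact absurd ⟨d, Finset.mem_union_right _ hd, by
                  rwa [← Finset.union_assoc]⟩ hb
              · exact hw _
              · exact le_rfl
            unfold onlineCost
            rw [permitCost_congr hagree]
            rw [Finset.union_assoc] at h6 ⊢
            linarith
      have h3 := onlineCost_le (M := M) (r := r) hw (j := j) (H := H) (X := X) (by
        intro d hd
        by_contra hlt
        exact hev ⟨d, hd, by omega⟩)
      linarith

/-- Every online strategy has expected cost at least the weight of the most expensive permit. -/
theorem le_demandExpect_onlineCost (hM : 0 < M) (hw : ∀ j, 0 ≤ w j)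
    (hsucc : ∀ j, w (j + 1) = meanBlocks M * w j)
    (hr : ∀ S T d, S.filter (· ≤ d) = T.filter (· ≤ d) → r S d = r T d) (j c : ℕ)
    (H : Finset ℕ) (hH : ∀ d ∈ H, d / M ^ j < c) :
    w j ≤ demandExpect M j c (onlineCost M w r j H) := by
  induction j generalizing c H with
  | zero => simp [demandExpect, onlineCost, permitCost]
  | succ j ih =>
    rw [hsucc]
    refine le_chainExpect_onlineCost hM hw hsucc hr ih le_rfl _ _ fun d hd => ?_
    have := hH d hd
    rwa [div_pow_succ, Nat.div_lt_iff_lt_mul hM] at this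

theorem le_demandExpect_permitCost (hM : 0 < M) (hw : ∀ j, 0 ≤ w j)
    (hsucc : ∀ j, w (j + 1) = meanBlocks M * w j)
    (hr : ∀ S T d, S.filter (· ≤ d) = T.filter (· ≤ d) → r S d = r T d) {k : ℕ} (hk : 1 ≤ k)
    (hrk : ∀ S d, r S d < k) :
    w (k - 1) ≤ demandExpect M (k - 1) 0 (fun S => permitCost M w k S (r S)) := by
  refine (le_demandExpect_onlineCost hM hw hsucc hr (k - 1) 0 ∅ (by simp)).trans
    (demandExpect_mono hM _ _ _ _ fun X _ _ => ?_)
  have := onlineCost_le (M := M) (r := r) hw (j := k - 1) (H := ∅) (X := X)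
    (fun d _ => by rw [Nat.sub_add_cancel hk]; exact hrk _ _)
  rwa [Nat.sub_add_cancel hk, Finset.empty_union] at this

end online

/-! ### General facts on paging costs, next occurrences and measurability. -/

section general
variable {n k : ℕ}

theorem evictionCost_eq (w : Fin n → ℝ) (T : ℕ) (C : ℕ → Finset (Fin n)) :
    evictionCost w T C =
      ∑ p, w p * ((Finset.range T).filter fun t => p ∈ C t \ C (t + 1)).card := by
  have h : ∀ t, ∑ p ∈ C t \ C (t + 1), w p = ∑ p, if p ∈ C t \ C (t + 1) then w p else 0 := by
    intro t
    rw [Finset.sum_ite_mem, Finset.univ_inter]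
  unfold evictionCost
  rw [Finset.sum_congr rfl fun t _ => h t, Finset.sum_comm]
  refine Finset.sum_congr rfl fun p _ => ?_
  rw [← Finset.sum_filter, Finset.sum_const, nsmul_eq_mul, mul_comm]

theorem evictionCost_nonneg {w : Fin n → ℝ} (hw : ∀ p, 0 ≤ w p) (T : ℕ)
    (C : ℕ → Finset (Fin n)) : 0 ≤ evictionCost w T C :=
  Finset.sum_nonneg fun _ _ => Finset.sum_nonneg fun _ _ => hw _

theorem optCost_le {w : Fin n → ℝ} (hw : ∀ p, 0 ≤ w p) {B : List (Fin n)}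
    {C : ℕ → Finset (Fin n)} (hC : Feasible k B C) :
    optCost w k B ≤ evictionCost w B.length C := by
  refine csInf_le ⟨0, ?_⟩ ⟨C, hC, rfl⟩
  rintro x ⟨C, -, rfl⟩
  exact evictionCost_nonneg hw _ _

theorem optCost_nonneg {w : Fin n → ℝ} (hw : ∀ p, 0 ≤ w p) (k : ℕ) (B : List (Fin n)) :
    0 ≤ optCost w k B := by
  refine Real.sInf_nonneg ?_
  rintro x ⟨C, -, rfl⟩
  exact evictionCost_nonneg hw _ _

theorem predictionDistance_nonneg {w : Fin n → ℝ} (hw : ∀ p, 0 ≤ w p) (A B : List (Fin n)) :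
    0 ≤ predictionDistance w A B :=
  Finset.sum_nonneg fun _ _ => mul_nonneg (hw _) (abs_nonneg _)

theorem length_observations (A B : List (Fin n)) : (observations A B).length = B.length := by
  simp [observations]

theorem observations_take (A B : List (Fin n)) (T : ℕ) :
    (observations A B).take T = observations A (B.take T) := by
  simp only [observations, ← List.map_take]
  congr 1
  apply List.ext_getElem
  · simp
  · intro i h1 h2
    simp

theorem DetAlg.serves_schedule (a : DetAlg n k) (w : Fin n → ℝ) (A B : List (Fin n)) (i : ℕ)
    (hi : i < B.length) : B[i] ∈ a.schedule w A B (i + 1) := by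
  have hi' : i < (observations A B).length := by rwa [length_observations]
  have h : (observations A B).take (i + 1) =
      (observations A B).take i ++ [(observations A B)[i]] := by
    rw [List.take_append_getElem]
  rw [DetAlg.schedule, if_neg (by omega), h]
  have h2 : ((observations A B)[i]).request = B[i] := by simp [observations, observe]
  rw [← h2]
  exact a.serves _ _ _

theorem exists_evicted {α : Type*} {C : ℕ → Finset α} {p : α} {s t : ℕ} (hst : s ≤ t)
    (hs : p ∈ C s) (ht : p ∉ C t) : ∃ u, s ≤ u ∧ u < t ∧ p ∈ C u ∧ p ∉ C (u + 1) := by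
  induction t, hst using Nat.le_induction with
  | base => exact absurd hs ht
  | succ t hst ih =>
    by_cases h : p ∈ C t
    · exact ⟨t, hst, by omega, h, ht⟩
    · obtain ⟨u, h1, h2, h3⟩ := ih h
      exact ⟨u, h1, by omega, h3⟩

/-- Here `u` is a list index counted from 0, hence the time `u + 1`. The value `u = L.length`
encodes that there is no further occurrence. -/
theorem nextOcc_eq {L : List (Fin n)} {p : Fin n} {t u : ℕ} (htu : t ≤ u) (hu : u ≤ L.length)
    (h1 : ∀ v, t ≤ v → v < u → ∀ hv : v < L.length, L[v] ≠ p)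
    (h2 : ∀ hu : u < L.length, L[u] = p) : nextOcc L p t = u + 1 := by
  unfold nextOcc
  rcases hu.lt_or_eq with hu' | rfl
  · have hmem : p ∈ L.drop t := by
      rw [List.mem_iff_getElem]
      refine ⟨u - t, by rw [List.length_drop]; omega, ?_⟩
      rw [List.getElem_drop]
      simp only [Nat.add_sub_cancel' htu]
      exact h2 hu'
    rw [if_pos hmem]
    have hlt := List.idxOf_lt_length_of_mem hmem
    have hget := List.getElem_idxOf hlt
    rw [List.getElem_drop] at hget
    have h3 : ¬ t + (L.drop t).idxOf p < u := fun hlt' =>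
      h1 _ (by omega) hlt' (by omega) hget
    have h4 : ¬ u < t + (L.drop t).idxOf p := by
      intro hlt'
      have h5 : u - t < (L.drop t).idxOf p := by omega
      have h6 := List.not_of_lt_findIdx h5
      rw [List.getElem_drop] at h6
      simp only [Nat.add_sub_cancel' htu, h2 hu'] at h6
      simp at h6
    omega
  · rw [if_neg]
    intro hmem
    obtain ⟨i, hi, rfl⟩ := List.mem_iff_getElem.1 hmem
    rw [List.length_drop] at hi
    rw [List.getElem_drop] at h1
    exact h1 (t + i) (by omega) (by omega) (by omega) rfl

theorem exists_next (L : List (Fin n)) (p : Fin n) {t : ℕ} (ht : t ≤ L.length) :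
    ∃ u, t ≤ u ∧ u ≤ L.length ∧ (∀ v, t ≤ v → v < u → ∀ hv : v < L.length, L[v] ≠ p) ∧
      ∀ hu : u < L.length, L[u] = p := by
  classical
  have hex : ∃ u, t ≤ u ∧ u ≤ L.length ∧ ∀ hu : u < L.length, L[u] = p :=
    ⟨L.length, ht, le_rfl, fun h => absurd h (lt_irrefl _)⟩
  obtain ⟨h1, h2, h3⟩ := Nat.find_spec hex
  refine ⟨Nat.find hex, h1, h2, fun v hv hvu hvL heq => ?_, h3⟩
  exact Nat.find_min hex hvu ⟨hv, hvL.le, fun _ => heq⟩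

theorem nextOcc_le (L : List (Fin n)) (p : Fin n) {t : ℕ} (ht : t ≤ L.length) :
    nextOcc L p t ≤ L.length + 1 := by
  obtain ⟨u, h1, h2, h3, h4⟩ := exists_next L p ht
  rw [nextOcc_eq h1 h2 h3 h4]
  omega

section measurability

theorem DetAlg.measurable_schedule (w : Fin n → ℝ) (A B : List (Fin n)) (t : ℕ) :
    @Measurable _ _ _ ⊤ fun a : DetAlg n k => a.schedule w A B t := by
  let _ : MeasurableSpace (Finset (Fin n)) := ⊤
  unfold DetAlg.schedule
  split_ifs
  · exact measurable_const
  · have h : Measurable[MeasurableSpace.comap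
        (fun a : DetAlg n k => a.cache w ((observations A B).take t)) ⊤]
        (fun a : DetAlg n k => a.cache w ((observations A B).take t)) := comap_measurable _
    exact h.mono (le_iSup₂_of_le w ((observations A B).take t) le_rfl) le_rfl

theorem DetAlg.measurable_cost (w : Fin n → ℝ) (A B : List (Fin n)) :
    Measurable fun a : DetAlg n k => a.cost w A B := by
  let _ : MeasurableSpace (Finset (Fin n)) := ⊤
  have : DiscreteMeasurableSpace (Finset (Fin n)) := ⟨fun _ => trivial⟩
  unfold DetAlg.cost evictionCost
  refine Finset.measurable_sum _ fun t _ => ?_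
  have h : Measurable fun x : Finset (Fin n) × Finset (Fin n) => ∑ p ∈ x.1 \ x.2, w p :=
    Measurable.of_discrete
  exact h.comp ((DetAlg.measurable_schedule w A B t).prodMk
    (DetAlg.measurable_schedule w A B (t + 1)))

theorem DetAlg.integrable_cost (μ : Measure (DetAlg n k)) [IsFiniteMeasure μ] {w : Fin n → ℝ}
    (hw : ∀ p, 0 ≤ w p) (A B : List (Fin n)) :
    Integrable (fun a : DetAlg n k => a.cost w A B) μ := by
  refine Integrable.of_bound (DetAlg.measurable_cost w A B).aestronglyMeasurable
    (∑ t ∈ Finset.range B.length, ∑ p, w p) (Filter.Eventually.of_forall fun a => ?_)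
  rw [DetAlg.cost, Real.norm_of_nonneg (evictionCost_nonneg hw _ _)]
  exact Finset.sum_le_sum fun t _ => Finset.sum_le_sum_of_subset_of_nonneg (Finset.subset_univ _)
    fun p _ _ => hw p

end measurability
end general

/-! ### The paging instances and the permits an online algorithm pays for. -/

section instances
variable {n k : ℕ}

/-- The pages `0, …, k` used in the instances. -/
def page (h : k < n) (j : ℕ) : Fin n := ⟨min j k, by omega⟩

theorem page_inj (h : k < n) {i j : ℕ} (hi : i ≤ k) (hj : j ≤ k) :
    page h i = page h j ↔ i = j := by
  rw [page, page, Fin.mk.injEq, min_eq_left hi, min_eq_left hj]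

/-- The requests are grouped into days of `k + 2` time steps. Page `j < k` is requested on all days
divisible by `M ^ j`, page `k` is requested at the end of the days in `S`, and the remaining
requests are to page `0`. -/
def requestLevel (M k : ℕ) (S : Finset ℕ) (u : ℕ) : ℕ :=
  if u % (k + 2) = k + 1 ∧ u / (k + 2) ∈ S then k
  else if u % (k + 2) < k ∧ M ^ (u % (k + 2)) ∣ u / (k + 2) then u % (k + 2) else 0

theorem requestLevel_le (M k : ℕ) (S : Finset ℕ) (u : ℕ) : requestLevel M k S u ≤ k := by
  unfold requestLevel
  split_ifs <;> omega

/-- The input sequence of `D` days with demands on the days in `S`. -/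
def demandInput (h : k < n) (M D : ℕ) (S : Finset ℕ) : List (Fin n) :=
  (List.range (D * (k + 2))).map fun u => page h (requestLevel M k S u)

@[simp]
theorem length_demandInput (h : k < n) (M D : ℕ) (S : Finset ℕ) :
    (demandInput h M D S).length = D * (k + 2) := by
  simp [demandInput]

@[simp]
theorem getElem_demandInput (h : k < n) (M D : ℕ) (S : Finset ℕ) (u : ℕ)
    (hu : u < (demandInput h M D S).length) :
    (demandInput h M D S)[u] = page h (requestLevel M k S u) := by
  simp [demandInput]

/-- The weights of the pages: `w j` for page `j < k`, and `η` for page `k`. -/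
noncomputable def pageWeight (k : ℕ) (w : ℕ → ℝ) (η : ℝ) (p : Fin n) : ℝ :=
  if p.val < k then w p.val else if p.val = k then η else 1

theorem pageWeight_pos {w : ℕ → ℝ} (hw : ∀ j, 0 < w j) {η : ℝ} (hη : 0 < η) (p : Fin n) :
    0 < pageWeight k w η p := by
  unfold pageWeight
  split_ifs
  · exact hw _
  · exact hη
  · exact one_pos

theorem pageWeight_page_of_lt (h : k < n) (w : ℕ → ℝ) (η : ℝ) {j : ℕ} (hj : j < k) :
    pageWeight k w η (page h j) = w j := by
  simp [pageWeight, page, min_eq_left hj.le, hj]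

theorem pageWeight_page_self (h : k < n) (w : ℕ → ℝ) (η : ℝ) :
    pageWeight k w η (page h k) = η := by
  simp [pageWeight, page]

open Classical in
/-- The smallest level whose page is missing in the cache `C`. -/
noncomputable def missingLevel (h : k < n) (C : Finset (Fin n)) : ℕ :=
  if hex : ∃ j < k, page h j ∉ C then Nat.find hex else 0

theorem missingLevel_lt (h : k < n) (hk : 1 ≤ k) (C : Finset (Fin n)) : missingLevel h C < k := by
  classical
  unfold missingLevel
  split_ifs with hex
  · exact (Nat.find_spec hex).1
  · exact hk

/-- Pigeonhole: a cache of size `k` that contains page `k` cannot contain all pages below `k`. So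
the default value in `missingLevel` plays no role on demand days. -/
theorem page_missingLevel_notMem (h : k < n) {C : Finset (Fin n)} (hC : C.card ≤ k)
    (hp : page h k ∈ C) : page h (missingLevel h C) ∉ C := by
  classical
  have hex : ∃ j < k, page h j ∉ C := by
    by_contra! hcon
    have hsub : (Finset.range (k + 1)).image (page h) ⊆ C := by
      intro p hp'
      obtain ⟨j, hj, rfl⟩ := Finset.mem_image.1 hp'
      rcases (Nat.lt_succ_iff.1 (Finset.mem_range.1 hj)).lt_or_eq with hj | rfl
      · exact hcon j hj
      · exact hp
    have := Finset.card_le_card hsub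
    rw [Finset.card_image_of_injOn, Finset.card_range] at this
    · omega
    · intro i hi j hj hij
      rw [Finset.mem_coe, Finset.mem_range] at hi hj
      exact (page_inj h (by omega) (by omega)).1 hij
  rw [missingLevel, dif_pos hex]
  exact (Nat.find_spec hex).2

/-- The permit bought by an algorithm on day `d`: the level of a page that is missing at the end of
the day. -/
noncomputable def DetAlg.permit (a : DetAlg n k) (h : k < n) (W : Fin n → ℝ) (A : List (Fin n))
    (M D : ℕ) (S : Finset ℕ) (d : ℕ) : ℕ :=
  missingLevel h
    (a.cache W (observations A ((demandInput h M D S).take ((d + 1) * (k + 2)))))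

theorem div_add_two_of_eq {k d s : ℕ} (hs : s < k + 2) :
    (d * (k + 2) + s) / (k + 2) = d ∧ (d * (k + 2) + s) % (k + 2) = s := by
  constructor
  · rw [add_comm, Nat.add_mul_div_right _ _ (by omega), Nat.div_eq_of_lt hs, zero_add]
  · rw [add_comm, Nat.add_mul_mod_self_right, Nat.mod_eq_of_lt hs]

/-- Non-anticipation: the inputs for `S` and `T` agree up to the end of day `d`, and the prediction
sequence is fixed. -/
theorem DetAlg.permit_congr (a : DetAlg n k) (h : k < n) (W : Fin n → ℝ) (A : List (Fin n))
    (M D : ℕ) (S T : Finset ℕ) (d : ℕ) (hST : S.filter (· ≤ d) = T.filter (· ≤ d)) :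
    a.permit h W A M D S d = a.permit h W A M D T d := by
  unfold DetAlg.permit
  suffices (demandInput h M D S).take ((d + 1) * (k + 2)) =
      (demandInput h M D T).take ((d + 1) * (k + 2)) by rw [this]
  apply List.ext_getElem
  · simp
  · intro u h1 h2
    rw [List.length_take] at h1
    rw [List.getElem_take, List.getElem_take, getElem_demandInput, getElem_demandInput]
    have hu : u / (k + 2) ≤ d := by
      have : u / (k + 2) < d + 1 := (Nat.div_lt_iff_lt_mul (by omega)).2 (by omega)
      omega
    have hmem : u / (k + 2) ∈ S ↔ u / (k + 2) ∈ T := by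
      have := congrArg (u / (k + 2) ∈ ·) hST
      simpa [hu] using this
    simp only [requestLevel, hmem]

/-- Each level-`j` interval in which a permit of level `j` is used contains its own eviction of page
`j`, so permits are counted by evictions. -/
theorem permitCost_le_cost (a : DetAlg n k) (h : k < n) (hk : 1 ≤ k) {w : ℕ → ℝ}
    (hw : ∀ j, 0 < w j) {η : ℝ} (hη : 0 < η) (A : List (Fin n)) {M D : ℕ} (hM : 0 < M)
    {S : Finset ℕ} (hS : ∀ d ∈ S, d < D) :
    permitCost M w k S (a.permit h (pageWeight k w η) A M D S) ≤
      a.cost (pageWeight k w η) A (demandInput h M D S) := by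
  set W : Fin n → ℝ := pageWeight k w η with hW
  set B := demandInput h M D S with hB
  set C := a.schedule W A B with hC
  have hcard : ∀ j ∈ Finset.range k,
      ((S.filter (a.permit h W A M D S · = j)).image (· / M ^ j)).card ≤
        ((Finset.range B.length).filter fun t => page h j ∈ C t \ C (t + 1)).card := by
    intro j hj
    rw [Finset.mem_range] at hj
    refine le_trans (Finset.card_le_card ?_)
      (Finset.card_image_le (f := fun t => t / (k + 2) / M ^ j))
    intro c hc
    obtain ⟨d, hd, rfl⟩ := Finset.mem_image.1 hc
    obtain ⟨hdS, hdj⟩ := Finset.mem_filter.1 hd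
    have hdD := hS d hdS
    have hT : (d + 1) * (k + 2) ≤ D * (k + 2) := Nat.mul_le_mul_right _ hdD
    have hd1 : (d + 1) * (k + 2) = d * (k + 2) + (k + 1) + 1 := by ring
    have hCT : C ((d + 1) * (k + 2)) =
        a.cache W (observations A (B.take ((d + 1) * (k + 2)))) := by
      rw [hC, DetAlg.schedule, if_neg (by positivity), observations_take]
    have hout : page h j ∉ C ((d + 1) * (k + 2)) := by
      rw [← hdj, DetAlg.permit, ← hB, ← hCT]
      refine page_missingLevel_notMem h ?_ ?_
      · rw [hCT]; exact a.card_le _ _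
      · rw [hd1]
        have := a.serves_schedule W A B (d * (k + 2) + (k + 1)) (by simp [hB]; omega)
        rw [getElem_demandInput, requestLevel, (div_add_two_of_eq (by omega)).1,
          (div_add_two_of_eq (by omega)).2, if_pos ⟨rfl, hdS⟩] at this
        exact this
    -- The first day of the interval, on which page `j` is requested; it is missing at the end of
    -- day `d`, so it is evicted in between.
    set e := d / M ^ j * M ^ j with he
    have hed : e ≤ d := Nat.div_mul_le_self _ _
    have hek : e * (k + 2) ≤ d * (k + 2) := Nat.mul_le_mul_right _ hed
    have hin : page h j ∈ C (e * (k + 2) + j + 1) := by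
      have := a.serves_schedule W A B (e * (k + 2) + j) (by simp [hB]; omega)
      rw [getElem_demandInput, requestLevel, (div_add_two_of_eq (by omega)).1,
          (div_add_two_of_eq (by omega)).2, if_neg (by omega),
          if_pos ⟨hj, Dvd.intro_left _ rfl⟩] at this
      exact this
    obtain ⟨t, ht1, ht2, ht3, ht4⟩ := exists_evicted (by omega) hin hout
    refine Finset.mem_image.2 ⟨t, Finset.mem_filter.2 ⟨?_, Finset.mem_sdiff.2 ⟨ht3, ht4⟩⟩, ?_⟩
    · simp [hB]; omega
    · have h1 : e ≤ t / (k + 2) := (Nat.le_div_iff_mul_le (by omega)).2 (by omega)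
      have h2 : t / (k + 2) ≤ d := by
        have : t / (k + 2) < d + 1 := (Nat.div_lt_iff_lt_mul (by omega)).2 (by omega)
        omega
      apply le_antisymm
      · exact Nat.div_le_div_right h2
      · exact (Nat.le_div_iff_mul_le (by positivity)).2 h1
  have hinj : Set.InjOn (page h) (Finset.range k : Finset ℕ) := by
    intro i hi j hj hij
    rw [Finset.mem_coe, Finset.mem_range] at hi hj
    exact (page_inj h (by omega) (by omega)).1 hij
  rw [DetAlg.cost, evictionCost_eq]
  calc permitCost M w k S (a.permit h W A M D S)
      ≤ ∑ j ∈ Finset.range k, W (page h j) *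
          ((Finset.range B.length).filter fun t => page h j ∈ C t \ C (t + 1)).card := by
        refine Finset.sum_le_sum fun j hj => ?_
        rw [hW, pageWeight_page_of_lt h w η (Finset.mem_range.1 hj)]
        exact mul_le_mul_of_nonneg_left (by exact_mod_cast hcard j hj) (hw j).le
    _ = ∑ p ∈ (Finset.range k).image (page h), W p *
          ((Finset.range B.length).filter fun t => p ∈ C t \ C (t + 1)).card := by
        rw [Finset.sum_image hinj]
    _ ≤ _ := Finset.sum_le_sum_of_subset_of_nonneg (Finset.subset_univ _) fun p _ _ =>
        mul_nonneg (pageWeight_pos hw hη p).le (Nat.cast_nonneg _)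

end instances

/-! ### From permits to an offline schedule. -/

section offline
variable {n k : ℕ}

open Classical in
/-- The level of the longest permit in use on day `d`, if the permits of level `g e` are bought for
the days `e ∈ S`; it is `k` if there is no such permit. -/
noncomputable def holeLevel (M k : ℕ) (S : Finset ℕ) (g : ℕ → ℕ) (d : ℕ) : ℕ :=
  if ∃ j < k, ∃ e ∈ S, g e = j ∧ e / M ^ j = d / M ^ j then
    Nat.findGreatest (fun j => ∃ e ∈ S, g e = j ∧ e / M ^ j = d / M ^ j) (k - 1)
  else k

section holeLevel
variable {M : ℕ} {S : Finset ℕ} {g : ℕ → ℕ}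

theorem holeLevel_le (d : ℕ) : holeLevel M k S g d ≤ k := by
  classical
  unfold holeLevel
  split_ifs
  · exact (Nat.findGreatest_le _).trans (Nat.sub_le _ _)
  · exact le_rfl

theorem holeLevel_lt {d j : ℕ} (hj : j < k) (h : ∃ e ∈ S, g e = j ∧ e / M ^ j = d / M ^ j) :
    holeLevel M k S g d < k := by
  classical
  unfold holeLevel
  rw [if_pos ⟨j, hj, h⟩]
  have := Nat.findGreatest_le (P := fun j => ∃ e ∈ S, g e = j ∧ e / M ^ j = d / M ^ j) (k - 1)
  omega

theorem holeLevel_spec {d : ℕ} (h : holeLevel M k S g d < k) :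
    ∃ e ∈ S, g e = holeLevel M k S g d ∧
      e / M ^ holeLevel M k S g d = d / M ^ holeLevel M k S g d := by
  classical
  unfold holeLevel at h ⊢
  split_ifs at h ⊢ with h'
  · obtain ⟨j, hj, hex⟩ := h'
    exact Nat.findGreatest_spec (P := fun j => ∃ e ∈ S, g e = j ∧ e / M ^ j = d / M ^ j)
      (by omega : j ≤ k - 1) hex
  · omega

theorem le_holeLevel {d j : ℕ} (hj : j < k) (h : ∃ e ∈ S, g e = j ∧ e / M ^ j = d / M ^ j) :
    j ≤ holeLevel M k S g d := by
  classical
  unfold holeLevel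
  rw [if_pos ⟨j, hj, h⟩]
  exact Nat.le_findGreatest (by omega) h

theorem div_pow_pred {d j : ℕ} (h : ¬ M ^ j ∣ d) : (d - 1) / M ^ j = d / M ^ j := by
  obtain ⟨d, rfl⟩ : ∃ d', d = d' + 1 := ⟨d - 1, by
    have : d ≠ 0 := by rintro rfl; exact h (dvd_zero _)
    omega⟩
  rw [Nat.succ_div, if_neg h]
  simp

/-- Away from the first day of the interval of the longest permit, days `d - 1` and `d` lie in the
same interval at that level and at all higher ones. So the longest permit can only change at such a
first day. -/
theorem holeLevel_pred {d : ℕ} (h : ¬ M ^ holeLevel M k S g d ∣ d)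
    (hlt : holeLevel M k S g d < k) :
    holeLevel M k S g (d - 1) = holeLevel M k S g d := by
  have hd : ∀ i, holeLevel M k S g d ≤ i → (d - 1) / M ^ i = d / M ^ i := fun i hi =>
    div_pow_pred fun hdvd => h ((pow_dvd_pow _ hi).trans hdvd)
  have h1 := holeLevel_spec hlt
  rw [← hd _ le_rfl] at h1
  have h2 := le_holeLevel hlt h1
  refine le_antisymm ?_ h2
  have h3 := holeLevel_spec (holeLevel_lt hlt h1)
  rw [hd _ h2] at h3
  exact le_holeLevel (holeLevel_lt hlt h1) h3

end holeLevel

/-- The page among `0, …, k` that is missing in the offline schedule after the `u`-th request. -/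
noncomputable def holeAt (M k : ℕ) (S : Finset ℕ) (g : ℕ → ℕ) (u : ℕ) : ℕ :=
  if u % (k + 2) = k + 1 ∨ ¬ M ^ holeLevel M k S g (u / (k + 2)) ∣ u / (k + 2) then
    holeLevel M k S g (u / (k + 2))
  else k

theorem holeAt_le (M : ℕ) (S : Finset ℕ) (g : ℕ → ℕ) (u : ℕ) : holeAt M k S g u ≤ k := by
  unfold holeAt
  split_ifs
  · exact holeLevel_le _
  · exact le_rfl

/-- The offline schedule that uses the permits of level `g e` for the days `e ∈ S`. -/
noncomputable def offlineSchedule (h : k < n) (M : ℕ) (S : Finset ℕ) (g : ℕ → ℕ) :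
    ℕ → Finset (Fin n)
  | 0 => ∅
  | u + 1 => ((Finset.range (k + 1)).image (page h)).erase (page h (holeAt M k S g u))

theorem injOn_page (h : k < n) : Set.InjOn (page h) (Finset.range (k + 1) : Finset ℕ) := by
  intro i hi j hj hij
  rw [Finset.mem_coe, Finset.mem_range] at hi hj
  exact (page_inj h (by omega) (by omega)).1 hij

theorem requestLevel_ne_holeAt {M : ℕ} {S : Finset ℕ} {g : ℕ → ℕ} (hk : 1 ≤ k)
    (hg : ∀ d ∈ S, g d < k) (u : ℕ) : requestLevel M k S u ≠ holeAt M k S g u := by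
  have hmod := Nat.mod_lt u (show 0 < k + 2 by omega)
  unfold requestLevel holeAt
  split_ifs with h1 h2 h3 h4 h5
  · exact (holeLevel_lt (hg _ h1.2) ⟨_, h1.2, rfl, rfl⟩).ne'
  · exact absurd (Or.inl h1.1) h2
  · intro heq
    rcases h4 with h4 | h4
    · omega
    · rw [← heq] at h4
      exact h4 h3.2
  · omega
  · intro heq
    rcases h5 with h5 | h5
    -- A level-0 permit is valid only on its own day, so the last slot of that day is a demand and
    -- does not request page 0.
    · obtain ⟨e, he, -, hdiv⟩ := holeLevel_spec (M := M) (S := S) (g := g)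
        (d := u / (k + 2)) (k := k) (by omega)
      rw [← heq, pow_zero, Nat.div_one, Nat.div_one] at hdiv
      exact h1 ⟨h5, hdiv ▸ he⟩
    · rw [← heq, pow_zero] at h5
      exact h5 (one_dvd _)
  · omega

theorem feasible_offlineSchedule (h : k < n) (hk : 1 ≤ k) (M D : ℕ) {S : Finset ℕ} {g : ℕ → ℕ}
    (hg : ∀ d ∈ S, g d < k) :
    Feasible k (demandInput h M D S) (offlineSchedule h M S g) where
  init := rfl
  card_le t := by
    cases t with
    | zero => simp [offlineSchedule]
    | succ u =>
      rw [offlineSchedule, Finset.card_erase_of_mem, Finset.card_image_of_injOn (injOn_page h)]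
      · simp
      · exact Finset.mem_image_of_mem _ (Finset.mem_range.2 (by
          have := holeAt_le (k := k) M S g u; omega))
  serves i := by
    rw [List.get_eq_getElem, getElem_demandInput, offlineSchedule, Finset.mem_erase, Ne,
      page_inj h (requestLevel_le _ _ _ _) (holeAt_le _ _ _ _)]
    refine ⟨requestLevel_ne_holeAt hk hg _, Finset.mem_image_of_mem _ (Finset.mem_range.2 ?_)⟩
    have := requestLevel_le M k S i.val
    omega

/-- Page `j` is dropped only at the end of the first day of its interval, after its request there.
This gives at most one eviction per permit. -/
theorem holeAt_start {M : ℕ} {S : Finset ℕ} {g : ℕ → ℕ} {u j : ℕ} (hj : j < k)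
    (h1 : holeAt M k S g (u + 1) = j) (h2 : holeAt M k S g u ≠ j) :
    (u + 1) % (k + 2) = k + 1 ∧ holeLevel M k S g ((u + 1) / (k + 2)) = j ∧
      M ^ j ∣ (u + 1) / (k + 2) := by
  have hlev : holeLevel M k S g ((u + 1) / (k + 2)) = j := by
    unfold holeAt at h1
    split_ifs at h1
    · exact h1
    · omega
  have hdvd : M ^ j ∣ (u + 1) / (k + 2) := by
    by_contra hnd
    -- Otherwise the hole was already `j` one step earlier, either late on the previous day or
    -- earlier on the same day.
    refine h2 ?_
    rcases Nat.eq_zero_or_pos ((u + 1) % (k + 2)) with h0 | h0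
    · have hprev : u / (k + 2) = (u + 1) / (k + 2) - 1 ∧ u % (k + 2) = k + 1 := by
        obtain ⟨c, hc⟩ := Nat.dvd_of_mod_eq_zero h0
        obtain ⟨c, rfl⟩ : ∃ c', c = c' + 1 := ⟨c - 1, by
          have : c ≠ 0 := by rintro rfl; simp at hc
          omega⟩
        have hu : u = c * (k + 2) + (k + 1) := by
          have : (k + 2) * (c + 1) = c * (k + 2) + (k + 1) + 1 := by ring
          omega
        rw [hc, Nat.mul_div_cancel_left _ (by omega), hu]
        exact div_add_two_of_eq (by omega)
      unfold holeAt
      rw [if_pos (Or.inl hprev.2), hprev.1, holeLevel_pred (by rwa [hlev]) (by omega), hlev]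
    · have hsame : u / (k + 2) = (u + 1) / (k + 2) := by
        rw [Nat.succ_div, if_neg, add_zero]
        exact fun hd => h0.ne' (Nat.mod_eq_zero_of_dvd hd)
      unfold holeAt
      rw [hsame, hlev, if_pos (Or.inr hnd)]
  refine ⟨?_, hlev, hdvd⟩
  unfold holeAt at h1
  split_ifs at h1 with h
  · rcases h with h | h
    · exact h
    · rw [hlev] at h
      exact absurd hdvd h
  · omega

/-- Evictions of page `j < k` inject into the level-`j` intervals with a permit. Page `k` may be
evicted at every step, which costs at most `η` each time. -/
theorem optCost_demandInput_le (h : k < n) (hk : 1 ≤ k) {w : ℕ → ℝ} (hw : ∀ j, 0 < w j) {η : ℝ}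
    (hη : 0 < η) (M D : ℕ) {S : Finset ℕ} {g : ℕ → ℕ} (hg : ∀ d ∈ S, g d < k) :
    optCost (pageWeight k w η) k (demandInput h M D S) ≤
      permitCost M w k S g + η * (D * (k + 2) : ℕ) := by
  refine (optCost_le (fun p => (pageWeight_pos hw hη p).le)
    (feasible_offlineSchedule h hk M D hg)).trans ?_
  rw [evictionCost_eq, length_demandInput]
  set C := offlineSchedule h M S g with hC
  set N := D * (k + 2) with hN
  have hout : ∀ p, p ∉ (Finset.range (k + 1)).image (page h) →
      pageWeight k w η p * ((Finset.range N).filter fun t => p ∈ C t \ C (t + 1)).card = 0 := by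
    intro p hp
    have : ((Finset.range N).filter fun t => p ∈ C t \ C (t + 1)) = ∅ := by
      refine Finset.filter_eq_empty_iff.2 fun t _ hpt => hp ?_
      have hpt := (Finset.mem_sdiff.1 hpt).1
      cases t with
      | zero => simp [hC, offlineSchedule] at hpt
      | succ u => exact Finset.mem_of_mem_erase hpt
    rw [this, Finset.card_empty, Nat.cast_zero, mul_zero]
  rw [← Finset.sum_subset (Finset.subset_univ ((Finset.range (k + 1)).image (page h)))
    fun p _ hp => hout p hp, Finset.sum_image (injOn_page h), Finset.sum_range_succ,
    pageWeight_page_self]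
  refine add_le_add (Finset.sum_le_sum fun j hj => ?_) ?_
  · rw [Finset.mem_range] at hj
    rw [pageWeight_page_of_lt h w η hj]
    refine mul_le_mul_of_nonneg_left ?_ (hw j).le
    have key : ∀ t, page h j ∈ C t \ C (t + 1) → t % (k + 2) = k + 1 ∧
        holeLevel M k S g (t / (k + 2)) = j ∧ M ^ j ∣ t / (k + 2) := by
      intro t ht
      obtain ⟨ht1, ht2⟩ := Finset.mem_sdiff.1 ht
      cases t with
      | zero => simp [hC, offlineSchedule] at ht1
      | succ u =>
        simp only [hC, offlineSchedule, Finset.mem_erase, not_and, Ne,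
          page_inj h hj.le (holeAt_le _ _ _ _)] at ht1 ht2
        refine holeAt_start hj ?_ (Ne.symm ht1.1)
        by_contra hne
        exact ht2 (Ne.symm hne) ht1.2
    have hle : ((Finset.range N).filter fun t => page h j ∈ C t \ C (t + 1)).card ≤
        ((S.filter (g · = j)).image (· / M ^ j)).card := by
      refine Finset.card_le_card_of_injOn (fun t => t / (k + 2) / M ^ j) ?_ ?_
      · intro t ht
        obtain ⟨-, hlev, -⟩ := key t (Finset.mem_filter.1 (Finset.mem_coe.1 ht)).2
        obtain ⟨e, he, hge, hdiv⟩ := holeLevel_spec (M := M) (S := S) (g := g)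
          (d := t / (k + 2)) (k := k) (by omega)
        rw [hlev] at hge hdiv
        exact Finset.mem_coe.2 (Finset.mem_image.2 ⟨e, Finset.mem_filter.2 ⟨he, hge⟩, hdiv⟩)
      · intro s hs t ht hst
        obtain ⟨hs1, -, hs2⟩ := key s (Finset.mem_filter.1 (Finset.mem_coe.1 hs)).2
        obtain ⟨ht1, -, ht2⟩ := key t (Finset.mem_filter.1 (Finset.mem_coe.1 ht)).2
        have hdiv : s / (k + 2) = t / (k + 2) := by
          rw [← Nat.div_mul_cancel hs2, ← Nat.div_mul_cancel ht2]
          exact congrArg (· * M ^ j) hst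
        rw [← Nat.div_add_mod s (k + 2), ← Nat.div_add_mod t (k + 2), hs1, ht1, hdiv]
    exact_mod_cast hle
  · refine mul_le_mul_of_nonneg_left ?_ hη.le
    exact_mod_cast (Finset.card_filter_le _ _).trans (Finset.card_range N).le

end offline

/-! ### The prediction distance of the instances. -/

section prediction
variable {n k : ℕ}

theorem requestLevel_empty_eq_zero {M : ℕ} {u : ℕ} (hu : u % (k + 2) = k + 1) :
    requestLevel M k ∅ u = 0 := by
  simp [requestLevel, hu]

theorem requestLevel_eq_self_iff {M : ℕ} {S : Finset ℕ} (hk : 1 ≤ k) {u : ℕ} :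
    requestLevel M k S u = k ↔ u % (k + 2) = k + 1 ∧ u / (k + 2) ∈ S := by
  unfold requestLevel
  split_ifs with h1 h2
  · exact iff_of_true rfl h1
  · exact iff_of_false (by omega) h1
  · exact iff_of_false (by omega) h1

theorem requestLevel_eq_empty {M : ℕ} {S : Finset ℕ} {u : ℕ}
    (h : ¬ (u % (k + 2) = k + 1 ∧ u / (k + 2) ∈ S)) :
    requestLevel M k S u = requestLevel M k ∅ u := by
  simp [requestLevel, h]

theorem requestLevel_slot {M : ℕ} {S : Finset ℕ} {u : ℕ} (h : u % (k + 2) = k) :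
    requestLevel M k S u = 0 := by
  simp [requestLevel, h]

theorem requestLevel_first {M : ℕ} {S : Finset ℕ} {u : ℕ} (h : u % (k + 2) = 0) :
    requestLevel M k S u = 0 := by
  simp [requestLevel, h]

/-- Two requests of page `0` surround each demand, so that its prediction is off by one. -/
theorem nextOcc_before_demand (h : k < n) (hk : 1 ≤ k) {M D : ℕ} {S : Finset ℕ} {i : ℕ}
    (hi : i % (k + 2) = k) (hiS : i / (k + 2) ∈ S) (hiN : i < D * (k + 2)) :
    nextOcc (demandInput h M D S) (page h 0) (i + 1) = i + 3 ∧
      nextOcc (demandInput h M D ∅) (page h 0) (i + 1) = i + 2 := by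
  have hdm := Nat.div_add_mod i (k + 2)
  have hi1 : (i + 1) % (k + 2) = k + 1 ∧ (i + 1) / (k + 2) = i / (k + 2) := by
    have : i + 1 = i / (k + 2) * (k + 2) + (k + 1) := by
      rw [mul_comm]; omega
    rw [this]
    exact ⟨(div_add_two_of_eq (by omega)).2, (div_add_two_of_eq (by omega)).1⟩
  have hi2 : (i + 2) % (k + 2) = 0 := by
    have : i + 2 = (k + 2) * (i / (k + 2) + 1) := by
      rw [mul_add]; omega
    rw [this, Nat.mul_mod_right]
  have hiN2 : i + 2 ≤ D * (k + 2) := by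
    have h1 : i / (k + 2) < D := (Nat.div_lt_iff_lt_mul (by omega)).2 hiN
    have h2 := Nat.mul_le_mul_left (k + 2) (show i / (k + 2) + 1 ≤ D from h1)
    rw [mul_add, mul_comm (k + 2) D] at h2
    omega
  constructor
  -- On the last day `i + 2` is the length of the input, and the default value `length + 1` is still
  -- `i + 3`.
  · refine nextOcc_eq (u := i + 2) (by omega) (by simpa using hiN2) ?_ ?_
    · intro v hv1 hv2 hv
      obtain rfl : v = i + 1 := by omega
      rw [getElem_demandInput, Ne, page_inj h (requestLevel_le _ _ _ _) (by omega),
        (requestLevel_eq_self_iff hk).2 ⟨hi1.1, by rwa [hi1.2]⟩]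
      omega
    · intro hu
      rw [getElem_demandInput, requestLevel_first hi2]
  · refine nextOcc_eq (u := i + 1) le_rfl (by simp; omega) (by intros; omega) ?_
    intro hu
    rw [getElem_demandInput, requestLevel_empty_eq_zero hi1.1]

/-- A demand replaces a request of page 0 that directly follows another one. Only that preceding
request can have the replaced one as its next occurrence. -/
theorem nextOcc_eq_of_not_demand (h : k < n) (hk : 1 ≤ k) {M D : ℕ} {S : Finset ℕ} {i j : ℕ}
    (hiN : i < D * (k + 2)) (hj : j < k)
    (hi : j = 0 → ¬ (i % (k + 2) = k ∧ i / (k + 2) ∈ S)) :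
    nextOcc (demandInput h M D S) (page h j) (i + 1) =
      nextOcc (demandInput h M D ∅) (page h j) (i + 1) := by
  obtain ⟨u, h1, h2, h3, h4⟩ := exists_next (demandInput h M D ∅) (page h j) (t := i + 1)
    (by simp; omega)
  rw [nextOcc_eq h1 h2 h3 h4]
  simp only [length_demandInput, getElem_demandInput, Ne,
    page_inj h (requestLevel_le _ _ _ _) hj.le] at h2 h3 h4
  have hback : ∀ v, requestLevel M k S v = j → requestLevel M k ∅ v = j := by
    intro v hv
    rw [← hv]
    refine (requestLevel_eq_empty fun hd => ?_).symm
    have := (requestLevel_eq_self_iff (M := M) hk).2 hd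
    omega
  refine nextOcc_eq h1 (by simpa using h2) ?_ ?_
  · intro v hv1 hv2 hv
    rw [getElem_demandInput, Ne, page_inj h (requestLevel_le _ _ _ _) hj.le]
    exact fun heq => h3 v hv1 hv2 (by simpa using hv) (hback v heq)
  · intro hu
    rw [getElem_demandInput, page_inj h (requestLevel_le _ _ _ _) hj.le]
    have hu' := h4 (by simpa using hu)
    rw [← hu']
    refine requestLevel_eq_empty fun hd => ?_
    have hj0 : j = 0 := by rw [← hu']; exact requestLevel_empty_eq_zero hd.1
    have hdm := Nat.div_add_mod u (k + 2)
    have hu1 : (u - 1) % (k + 2) = k ∧ (u - 1) / (k + 2) = u / (k + 2) := by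
      have : u - 1 = u / (k + 2) * (k + 2) + k := by
        rw [mul_comm]; omega
      rw [this]
      exact ⟨(div_add_two_of_eq (by omega)).2, (div_add_two_of_eq (by omega)).1⟩
    rcases Nat.lt_or_ge (u - 1) (i + 1) with hlt | hge
    · obtain rfl : i = u - 1 := by omega
      exact hi hj0 ⟨hu1.1, by rw [hu1.2]; exact hd.2⟩
    · refine h3 (u - 1) hge (by omega) (by omega) ?_
      rw [hj0, requestLevel_slot hu1.1]

theorem card_filter_slot_le (N s : ℕ) (S : Finset ℕ) :
    ((Finset.univ : Finset (Fin N)).filter fun i =>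
      i.val % (k + 2) = s ∧ i.val / (k + 2) ∈ S).card ≤ S.card := by
  refine Finset.card_le_card_of_injOn (fun i => i.val / (k + 2)) ?_ ?_
  · intro i hi
    exact (Finset.mem_filter.1 (Finset.mem_coe.1 hi)).2.2
  · intro i hi i' hi' hii
    have h1 := (Finset.mem_filter.1 (Finset.mem_coe.1 hi)).2.1
    have h2 := (Finset.mem_filter.1 (Finset.mem_coe.1 hi')).2.1
    dsimp only at hii
    apply Fin.ext
    rw [← Nat.div_add_mod i.val (k + 2), ← Nat.div_add_mod i'.val (k + 2), h1, h2, hii]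

/-- Each demand causes two errors: an error of 1 for the preceding request of page 0, and one of at
most `N + 1` for page `k`, which the factor `η` makes harmless. -/
theorem predictionDistance_le (h : k < n) (hk : 1 ≤ k) {w : ℕ → ℝ} (hw : ∀ j, 0 < w j) {η : ℝ}
    (hη : 0 < η) (M D : ℕ) (S : Finset ℕ) :
    predictionDistance (pageWeight k w η) (demandInput h M D ∅) (demandInput h M D S) ≤
      (w 0 + η * ((D * (k + 2) : ℕ) + 1)) * S.card := by
  set N := D * (k + 2) with hN
  have hη' : 0 ≤ η * ((N : ℝ) + 1) := by positivity
  have key : ∀ i : Fin (demandInput h M D S).length,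
      pageWeight k w η ((demandInput h M D S).get i) *
        |(nextOcc (demandInput h M D S) ((demandInput h M D S).get i) (i.val + 1) : ℝ) -
          (nextOcc (demandInput h M D ∅) ((demandInput h M D S).get i) (i.val + 1) : ℝ)| ≤
      (if i.val % (k + 2) = k ∧ i.val / (k + 2) ∈ S then w 0 else 0) +
        if i.val % (k + 2) = k + 1 ∧ i.val / (k + 2) ∈ S then η * ((N : ℝ) + 1) else 0 := by
    intro i
    have hiN : i.val < N := by simpa using i.2
    rw [List.get_eq_getElem, getElem_demandInput]
    rcases (requestLevel_le M k S i.val).lt_or_eq with hlt | heq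
    · have h2 : ¬ (i.val % (k + 2) = k + 1 ∧ i.val / (k + 2) ∈ S) := fun hd =>
        hlt.ne ((requestLevel_eq_self_iff hk).2 hd)
      rw [if_neg h2, add_zero, pageWeight_page_of_lt h w η hlt]
      by_cases hd : i.val % (k + 2) = k ∧ i.val / (k + 2) ∈ S
      · rw [if_pos hd, requestLevel_slot hd.1, (nextOcc_before_demand h hk hd.1 hd.2 hiN).1,
          (nextOcc_before_demand h hk hd.1 hd.2 hiN).2]
        push_cast
        rw [show ((i.val : ℝ) + 3 - (i.val + 2)) = 1 by ring]
        simp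
      · rw [if_neg hd, nextOcc_eq_of_not_demand h hk hiN hlt fun _ => hd]
        simp
    · rw [heq, pageWeight_page_self, if_pos ((requestLevel_eq_self_iff hk).1 heq)]
      have h1 := nextOcc_le (demandInput h M D S) (page h k) (t := i.val + 1) i.2
      have h2 := nextOcc_le (demandInput h M D ∅) (page h k) (t := i.val + 1) (by simp; omega)
      simp only [length_demandInput] at h1 h2
      have h1' : (nextOcc (demandInput h M D S) (page h k) (i.val + 1) : ℝ) ≤ (N : ℝ) + 1 := by
        exact_mod_cast h1
      have h2' : (nextOcc (demandInput h M D ∅) (page h k) (i.val + 1) : ℝ) ≤ (N : ℝ) + 1 := by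
        exact_mod_cast h2
      have h3 : |(nextOcc (demandInput h M D S) (page h k) (i.val + 1) : ℝ) -
          (nextOcc (demandInput h M D ∅) (page h k) (i.val + 1) : ℝ)| ≤ (N : ℝ) + 1 := by
        have h4 : (0 : ℝ) ≤ nextOcc (demandInput h M D S) (page h k) (i.val + 1) :=
          Nat.cast_nonneg _
        have h5 : (0 : ℝ) ≤ nextOcc (demandInput h M D ∅) (page h k) (i.val + 1) :=
          Nat.cast_nonneg _
        rw [abs_le]
        constructor <;> linarith
      have h6 := mul_le_mul_of_nonneg_left h3 hη.le
      have h7 : 0 ≤ if i.val % (k + 2) = k ∧ i.val / (k + 2) ∈ S then w 0 else 0 := by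
        split_ifs
        · exact (hw 0).le
        · exact le_rfl
      linarith
  refine (Finset.sum_le_sum fun i _ => key i).trans ?_
  rw [Finset.sum_add_distrib, ← Finset.sum_filter, ← Finset.sum_filter, Finset.sum_const,
    Finset.sum_const, nsmul_eq_mul, nsmul_eq_mul, add_mul]
  have c1 : (((Finset.univ : Finset (Fin (demandInput h M D S).length)).filter fun i =>
      i.val % (k + 2) = k ∧ i.val / (k + 2) ∈ S).card : ℝ) ≤ S.card := by
    exact_mod_cast card_filter_slot_le _ _ _
  have c2 : (((Finset.univ : Finset (Fin (demandInput h M D S).length)).filter fun i =>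
      i.val % (k + 2) = k + 1 ∧ i.val / (k + 2) ∈ S).card : ℝ) ≤ S.card := by
    exact_mod_cast card_filter_slot_le _ _ _
  have := mul_le_mul_of_nonneg_right c1 (hw 0).le
  have := mul_le_mul_of_nonneg_right c2 hη'
  linarith

theorem le_predictionDistance (h : k < n) (hk : 1 ≤ k) {w : ℕ → ℝ} (hw : ∀ j, 0 < w j) {η : ℝ}
    (hη : 0 < η) {M D : ℕ} {S : Finset ℕ} {d : ℕ} (hd : d ∈ S) (hdD : d < D) :
    w 0 ≤ predictionDistance (pageWeight k w η) (demandInput h M D ∅) (demandInput h M D S) := by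
  have hN : d * (k + 2) + k < D * (k + 2) := by
    have := Nat.mul_le_mul_right (k + 2) (show d + 1 ≤ D from hdD)
    rw [add_mul] at this
    omega
  have hslot := div_add_two_of_eq (d := d) (show k < k + 2 by omega)
  have hnext := nextOcc_before_demand (M := M) (D := D) (S := S) h hk hslot.2
    (by rwa [hslot.1]) hN
  refine le_trans ?_ (Finset.single_le_sum (f := fun i : Fin (demandInput h M D S).length =>
    pageWeight k w η ((demandInput h M D S).get i) *
      |(nextOcc (demandInput h M D S) ((demandInput h M D S).get i) (i.val + 1) : ℝ) -
        (nextOcc (demandInput h M D ∅) ((demandInput h M D S).get i) (i.val + 1) : ℝ)|)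
    (fun i _ => mul_nonneg (pageWeight_pos hw hη _).le (abs_nonneg _))
    (Finset.mem_univ (⟨d * (k + 2) + k, by simpa using hN⟩ : Fin (demandInput h M D S).length)))
  dsimp only
  rw [List.get_eq_getElem, getElem_demandInput, requestLevel_slot hslot.2, hnext.1, hnext.2,
    pageWeight_page_of_lt h w η hk]
  push_cast
  rw [show ((d : ℝ) * (k + 2) + k + 3 - (d * (k + 2) + k + 2)) = 1 by ring]
  simp

end prediction

/-! ### The choice of weights. -/

/-- Geometrically growing weights, for which the random demands are balanced. -/
noncomputable def levelWeight (M : ℕ) (s : ℝ) (j : ℕ) : ℝ := s * meanBlocks M ^ j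

section levelWeight
variable {M : ℕ} {s : ℝ}

theorem three_halves_le_meanBlocks (hM : 2 ≤ M) : 3 / 2 ≤ meanBlocks M := by
  have := meanBlocks_mono hM
  rw [meanBlocks_eq 2] at this
  linarith

theorem levelWeight_pos (hM : 2 ≤ M) (hs : 0 < s) (j : ℕ) : 0 < levelWeight M s j :=
  mul_pos hs (pow_pos (by linarith [three_halves_le_meanBlocks hM]) j)

theorem levelWeight_succ (j : ℕ) :
    levelWeight M s (j + 1) = meanBlocks M * levelWeight M s j := by
  rw [levelWeight, levelWeight, pow_succ]
  ring

theorem le_levelWeight (hM : 2 ≤ M) (hs : 0 < s) (j : ℕ) : s ≤ levelWeight M s j :=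
  le_mul_of_one_le_right hs.le (one_le_pow₀ (by linarith [three_halves_le_meanBlocks hM]))

theorem sum_levelWeight_le (hM : 2 ≤ M) (hs : 0 < s) (j : ℕ) :
    ∑ i ∈ Finset.range (j + 1), levelWeight M s i ≤ 3 * levelWeight M s j := by
  induction j with
  | zero =>
    have := levelWeight_pos hM hs 0
    simp only [zero_add, Finset.sum_range_one]
    linarith
  | succ j ih =>
    rw [Finset.sum_range_succ, levelWeight_succ]
    nlinarith [levelWeight_pos hM hs j, three_halves_le_meanBlocks hM]

/-- Going up `m + 1` levels multiplies the weight by at most `2 ^ (m + 1)` and the length by `(2 *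
k) ^ (m + 1)`, so the price per day drops by a factor of at least `k`. This is the reason for `M = 2
* k`. -/
theorem levelWeight_rate {k : ℕ} (hs : 0 < s) (hk : 1 ≤ k) {i j : ℕ} (hij : j < i) :
    (k : ℝ) * levelWeight (2 * k) s i * ((2 * k : ℕ) : ℝ) ^ j ≤
      levelWeight (2 * k) s j * ((2 * k : ℕ) : ℝ) ^ i := by
  obtain ⟨m, rfl⟩ : ∃ m, i = j + (m + 1) := ⟨i - j - 1, by omega⟩
  have hk1 : (1 : ℝ) ≤ k := by exact_mod_cast hk
  have hβ0 := meanBlocks_nonneg (2 * k)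
  have h1 : (k : ℝ) * meanBlocks (2 * k) ^ (m + 1) ≤ ((2 * k : ℕ) : ℝ) ^ (m + 1) := by
    push_cast
    rw [mul_pow, mul_comm]
    exact mul_le_mul (pow_le_pow_left₀ hβ0 (meanBlocks_le_two _) _)
      (le_self_pow₀ hk1 (by omega)) (by positivity) (by positivity)
  have h2 : 0 ≤ s * meanBlocks (2 * k) ^ j * ((2 * k : ℕ) : ℝ) ^ j := by positivity
  have h3 := mul_le_mul_of_nonneg_left h1 h2
  unfold levelWeight
  calc _ = s * meanBlocks (2 * k) ^ j * ((2 * k : ℕ) : ℝ) ^ j *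
        ((k : ℝ) * meanBlocks (2 * k) ^ (m + 1)) := by rw [pow_add]; ring
    _ ≤ _ := h3
    _ = _ := by rw [pow_add]; ring

/-- For `k` levels the optimum is smaller than the cost of online strategies by a
logarithmic factor. -/
theorem log_mul_demandExpect_blockOpt_le {k : ℕ} (hk : 1 ≤ k) (hs : 0 < s) :
    Real.log k * demandExpect (2 * k) (k - 1) 0 (blockOpt (2 * k) (levelWeight (2 * k) s) (k - 1) 0)
      ≤ 8 * levelWeight (2 * k) s (k - 1) := by
  have hw := levelWeight_pos (M := 2 * k) (by omega) hs
  rcases hk.eq_or_lt with rfl | hk2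
  · simpa using (hw 0).le
  -- With `2 ^ g ≤ k` there are enough levels for the decrease by `(1 / 2) ^ g` per level to reach
  -- `4 / g`, and `log k ≤ 2 * g` then gives the constant 8.
  set g := Nat.log 2 k with hg
  have hg0 : 0 < g := Nat.log_pos (by norm_num) hk2
  have hgk : g ≤ 2 * k := (Nat.log_le_self 2 k).trans (by omega)
  have hpow : 2 ^ g ≤ k := Nat.pow_log_le_self 2 (by omega)
  have hlt : k < 2 ^ (g + 1) := Nat.lt_pow_succ_log_self (by norm_num) k
  have hg0' : (0 : ℝ) < g := by exact_mod_cast hg0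
  have hg1' : (1 : ℝ) ≤ g := by exact_mod_cast hg0
  have hmax : max (4 / g : ℝ) (1 - ((k - 1 : ℕ) : ℝ) * (1 / 2) ^ g) = 4 / g := by
    refine max_eq_left ?_
    have h1 : (2 : ℝ) ^ g - 1 ≤ ((k - 1 : ℕ) : ℝ) := by
      have : (2 : ℝ) ^ g ≤ k := by exact_mod_cast hpow
      rw [Nat.cast_sub hk]
      push_cast
      linarith
    have h2 : (2 : ℝ) ^ g * (1 / 2) ^ g = 1 := by rw [← mul_pow]; norm_num
    have h3 : (0 : ℝ) < (1 / 2) ^ g := by positivity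
    have h4 := mul_le_mul_of_nonneg_right h1 h3.le
    have h5 : (g : ℝ) ≤ 2 ^ g := by exact_mod_cast Nat.lt_two_pow_self.le
    have h6 := mul_le_mul_of_nonneg_right h5 h3.le
    rw [le_div_iff₀ hg0']
    nlinarith
  have h1 := demandExpect_blockOpt_le (M := 2 * k) (by omega) hw levelWeight_succ hg0 hgk (k - 1) 0
  rw [hmax] at h1
  have h2 : Real.log k ≤ 2 * g := by
    have h3 : Real.log k ≤ Real.log (2 ^ (g + 1)) :=
      Real.log_le_log (by exact_mod_cast (show 0 < k by omega)) (by exact_mod_cast hlt.le)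
    rw [Real.log_pow] at h3
    push_cast at h3
    have h4 : Real.log 2 ≤ 1 := by linarith [Real.log_two_lt_d9]
    nlinarith
  have h3 : 0 ≤ Real.log k := Real.log_natCast_nonneg k
  calc _ ≤ Real.log k * (4 / g * levelWeight (2 * k) s (k - 1)) :=
        mul_le_mul_of_nonneg_left h1 h3
    _ ≤ 2 * g * (4 / g * levelWeight (2 * k) s (k - 1)) :=
        mul_le_mul_of_nonneg_right h2 (mul_nonneg (by positivity) (hw _).le)
    _ = _ := by field_simp; ring

end levelWeight

/-! ### Hard instances for deterministic and randomized algorithms. -/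

section bounds
variable {n k : ℕ}

/-- The weight of page `k` in the instances: so small that its total contribution is negligible. -/
noncomputable def tinyWeight (k : ℕ) (s : ℝ) : ℝ :=
  s / ((((2 * k) ^ (k - 1) * (k + 2) : ℕ) : ℝ) + 1)

theorem tinyWeight_pos (k : ℕ) {s : ℝ} (hs : 0 < s) : 0 < tinyWeight k s := by
  unfold tinyWeight
  positivity

theorem tinyWeight_mul (k : ℕ) (s : ℝ) :
    tinyWeight k s * ((((2 * k) ^ (k - 1) * (k + 2) : ℕ) : ℝ) + 1) = s := by
  unfold tinyWeight
  exact div_mul_cancel₀ _ (by positivity)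

/-- The weights of the hard instances. -/
noncomputable def hardWeight (k : ℕ) (s : ℝ) : Fin n → ℝ :=
  pageWeight k (levelWeight (2 * k) s) (tinyWeight k s)

theorem hardWeight_pos (hk : 1 ≤ k) {s : ℝ} (hs : 0 < s) (p : Fin n) : 0 < hardWeight k s p :=
  pageWeight_pos (levelWeight_pos (by omega) hs) (tinyWeight_pos k hs) p

/-- The input sequences of the hard instances. -/
def hardInput (h : k < n) (S : Finset ℕ) : List (Fin n) :=
  demandInput h (2 * k) ((2 * k) ^ (k - 1)) S

/-- All evictions of page `k` together cost at most `s`, which is no more than any single permit;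
this gives the factor 2. -/
theorem optCost_hardInput_le (h : k < n) (hk : 1 ≤ k) {s : ℝ} (hs : 0 < s) {S : Finset ℕ}
    (hS : S.Nonempty) {g : ℕ → ℕ} (hg : ∀ d ∈ S, g d < k) :
    optCost (hardWeight k s) k (hardInput h S) ≤
      2 * permitCost (2 * k) (levelWeight (2 * k) s) k S g := by
  obtain ⟨d, hd⟩ := hS
  have hw := levelWeight_pos (M := 2 * k) (by omega) hs
  have h1 := optCost_demandInput_le h hk hw (tinyWeight_pos k hs) (2 * k)
    ((2 * k) ^ (k - 1)) hg
  have h2 := le_permitCost (M := 2 * k) (fun j => (hw j).le) hd (hg d hd)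
  have h3 := le_levelWeight (M := 2 * k) (by omega) hs (g d)
  have h4 := tinyWeight_mul k s
  have h5 := tinyWeight_pos k hs
  unfold hardWeight hardInput
  linarith

theorem predictionDistance_hardInput_le (h : k < n) (hk : 1 ≤ k) {s : ℝ} (hs : 0 < s)
    (S : Finset ℕ) :
    predictionDistance (hardWeight k s) (hardInput h ∅) (hardInput h S) ≤ 2 * s * S.card := by
  refine (predictionDistance_le h hk (levelWeight_pos (by omega) hs) (tinyWeight_pos k hs)
    _ _ _).trans (le_of_eq ?_)
  rw [tinyWeight_mul, levelWeight, pow_zero]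
  ring

theorem le_predictionDistance_hardInput (h : k < n) (hk : 1 ≤ k) {s : ℝ} (hs : 0 < s)
    {S : Finset ℕ} (hS : S.Nonempty) (hlt : ∀ d ∈ S, d < (2 * k) ^ (k - 1)) :
    s ≤ predictionDistance (hardWeight k s) (hardInput h ∅) (hardInput h S) := by
  obtain ⟨d, hd⟩ := hS
  refine le_trans (le_of_eq ?_) (le_predictionDistance h hk (levelWeight_pos (by omega) hs)
    (tinyWeight_pos k hs) hd (hlt d hd))
  rw [levelWeight, pow_zero, mul_one]

theorem exists_instance_deterministic (hk : 1 ≤ k) (h : k < n) (a : DetAlg n k) (X : ℝ) :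
    ∃ (w : Fin n → ℝ) (A B : List (Fin n)), (∀ p, 0 < w p) ∧
      X ≤ predictionDistance w A B ∧
      1 / 20 * (k * optCost w k B + predictionDistance w A B) < a.cost w A B := by
  set s := max X 1 with hs'
  have hs : 0 < s := lt_of_lt_of_le one_pos (le_max_right _ _)
  set w := levelWeight (2 * k) s with hw'
  have hw : ∀ j, 0 < w j := levelWeight_pos (by omega) hs
  set W : Fin n → ℝ := hardWeight k s with hW
  set q := a.permit h W (hardInput h ∅) (2 * k) ((2 * k) ^ (k - 1)) with hq
  set S := uncovered (2 * k) q ((2 * k) ^ (k - 1)) with hS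
  have hq' : (fun d => q (S.filter (· ≤ d)) d) = q S := by
    ext d
    exact DetAlg.permit_congr a h _ _ _ _ _ _ _ (by simp [Finset.filter_filter])
  have hG := greedy_uncovered (2 * k) ((2 * k) ^ (k - 1)) q
  rw [← hS, hq'] at hG
  have hqk : ∀ d ∈ S, q S d < k := fun d _ => missingLevel_lt h hk _
  have hne : S.Nonempty := by
    obtain ⟨e, he, -⟩ := hG.cover 0 (by positivity)
    exact ⟨e, he⟩
  obtain ⟨i, hi, hopt⟩ := hG.exists_level (by omega) hk hw
    (fun i j hij => levelWeight_rate hs hk hij) (sum_levelWeight_le (by omega) hs) hqk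
  have h1 := optCost_hardInput_le h hk hs hne (g := fun _ => i) fun _ _ => hi
  have h2 := predictionDistance_hardInput_le h hk hs S
  have h3 := le_predictionDistance_hardInput h hk hs hne hG.lt
  have h4 : permitCost (2 * k) w k S (q S) ≤ a.cost W (hardInput h ∅) (hardInput h S) :=
    permitCost_le_cost a h hk hw (tinyWeight_pos k hs) (hardInput h ∅) (by omega) hG.lt
  have h5 : s * S.card ≤ permitCost (2 * k) w k S (q S) := by
    rw [hG.permitCost_eq hqk, mul_comm, ← nsmul_eq_mul]
    exact Finset.card_nsmul_le_sum _ _ _ fun d _ => le_levelWeight (by omega) hs _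
  refine ⟨W, hardInput h ∅, hardInput h S, hardWeight_pos hk hs, (le_max_left _ _).trans h3, ?_⟩
  -- Now `k * OPT` is at most 8 times and the prediction distance at most 2 times the online cost,
  -- so 1/20 leaves room for strictness.
  have h6 := mul_le_mul_of_nonneg_left h1 (Nat.cast_nonneg (α := ℝ) k)
  have h7 : (0 : ℝ) < S.card := by exact_mod_cast hne.card_pos
  have h8 : 0 < s * S.card := mul_pos hs h7
  linarith

theorem exists_instance_randomized (hk : 1 ≤ k) (h : k < n) (R : RandAlg n k) (X : ℝ) :
    ∃ (w : Fin n → ℝ) (A B : List (Fin n)), (∀ p, 0 < w p) ∧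
      X ≤ predictionDistance w A B ∧
      1 / 20 * (Real.log k * optCost w k B + predictionDistance w A B) <
        R.expectedCost w A B := by
  set s := max X 1 with hs'
  have hs : 0 < s := lt_of_lt_of_le one_pos (le_max_right _ _)
  set w := levelWeight (2 * k) s with hw'
  have hw : ∀ j, 0 < w j := levelWeight_pos (by omega) hs
  set W : Fin n → ℝ := hardWeight k s with hW
  set A := hardInput h ∅ with hA
  have hM : 0 < 2 * k := by omega
  have hWpos : ∀ p, 0 < W p := hardWeight_pos hk hs
  have hint := demandExpect_integral (M := 2 * k) (μ := (R : Measure (DetAlg n k))) (k - 1) 0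
    (fun a S => a.cost W A (hardInput h S))
    fun S => DetAlg.integrable_cost _ (fun p => (hWpos p).le) _ _
  have hdays : ∀ S : Finset ℕ, (∀ d ∈ S, d / (2 * k) ^ (k - 1) = 0) →
      ∀ d ∈ S, d < (2 * k) ^ (k - 1) := by
    intro S hS d hd
    exact (Nat.div_eq_zero_iff_lt (by positivity)).1 (hS d hd)
  have hlower : w (k - 1) ≤
      demandExpect (2 * k) (k - 1) 0 (fun S => R.expectedCost W A (hardInput h S)) := by
    -- Yao's principle: the bound holds for each deterministic algorithm on the random input and is
    -- then integrated over algorithms.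
    have h1 : ∀ a : DetAlg n k, w (k - 1) ≤
        demandExpect (2 * k) (k - 1) 0 (fun S => a.cost W A (hardInput h S)) := by
      intro a
      refine (le_demandExpect_permitCost hM (fun j => (hw j).le) levelWeight_succ
        (DetAlg.permit_congr a h W A (2 * k) ((2 * k) ^ (k - 1))) hk
        (fun S d => missingLevel_lt h hk _)).trans ?_
      refine demandExpect_mono hM _ _ _ _ fun S _ hS => ?_
      exact permitCost_le_cost a h hk hw (tinyWeight_pos k hs) A hM (hdays S hS)
    have h2 := integral_mono (μ := (R : Measure (DetAlg n k))) (integrable_const _) hint.1 h1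
    rw [← hint.2, integral_const, probReal_univ, one_smul] at h2
    exact h2
  by_contra! hcon
  -- If no input were bad, the expected cost would be at most `8 / 10 + 1 / 10` of the top weight,
  -- contradicting `hlower`.
  have hupper : demandExpect (2 * k) (k - 1) 0 (fun S => R.expectedCost W A (hardInput h S)) ≤
      demandExpect (2 * k) (k - 1) 0 (fun S =>
        1 / 10 * (Real.log k * blockOpt (2 * k) w (k - 1) 0 S) + s / 10 * S.card) := by
    refine demandExpect_mono hM _ _ _ _ fun S hne hS => ?_
    have h1 := hcon W A (hardInput h S) hWpos
      ((le_max_left _ _).trans (le_predictionDistance_hardInput h hk hs hne (hdays S hS)))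
    obtain ⟨g, hg, hgc⟩ := exists_blockCost_le (M := 2 * k) (fun j => (hw j).le) hM S (k - 1) 0
    rw [blockCost, Nat.sub_add_cancel hk, Finset.filter_true_of_mem hS] at hgc
    have h2 := optCost_hardInput_le h hk hs hne (g := g) fun d _ => by have := hg d; omega
    have h3 := predictionDistance_hardInput_le h hk hs S
    have h4 := mul_le_mul_of_nonneg_left (h2.trans (mul_le_mul_of_nonneg_left hgc zero_le_two))
      (Real.log_natCast_nonneg k)
    linarith
  rw [demandExpect_add, demandExpect_mul, demandExpect_mul, demandExpect_mul] at hupper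
  have h1 := log_mul_demandExpect_blockOpt_le hk hs
  have h2 := mul_le_mul_of_nonneg_left (demandExpect_card hM (k - 1) 0) hs.le
  have h3 : s * meanBlocks (2 * k) ^ (k - 1) = w (k - 1) := rfl
  have h4 := hw (k - 1)
  linarith

end bounds

/-! ### Asymptotic consequences. -/

theorem isLittleO_eventually_le {α : Type*} {l : Filter α} {f g : α → ℝ} (h : f =o[l] g)
    (hg : ∀ᶠ x in l, 0 ≤ g x) {c : ℝ} (hc : 0 < c) : ∀ᶠ x in l, f x ≤ c * g x := by
  filter_upwards [h.bound hc, hg] with x hx hgx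
  rw [Real.norm_of_nonneg hgx] at hx
  exact (le_abs_self _).trans hx

end WeightedPaging

open WeightedPaging in
/-- The first two parts are the explicit form of the two lower bounds; the next two are the
resulting impossibility of `o(k) · OPT + o(ℓ_pd)` and of `o(log k) · OPT + o(ℓ_pd)`, and the last is
the impossibility of `O(OPT + √(ℓ_pd · OPT))`. A family of algorithms has one member for every
cache size `k ≥ 1` and every number `n > k` of pages. -/
theorem theorem4 :
    (∃ δ : ℝ, 0 < δ ∧ ∀ k n : ℕ, 1 ≤ k → k < n → ∀ a : DetAlg n k, ∀ X : ℝ,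
      ∃ (w : Fin n → ℝ) (A B : List (Fin n)), (∀ p, 0 < w p) ∧
        X ≤ predictionDistance w A B ∧
        δ * (k * optCost w k B + predictionDistance w A B) < a.cost w A B) ∧
    (∃ δ : ℝ, 0 < δ ∧ ∀ k n : ℕ, 1 ≤ k → k < n → ∀ R : RandAlg n k, ∀ X : ℝ,
      ∃ (w : Fin n → ℝ) (A B : List (Fin n)), (∀ p, 0 < w p) ∧
        X ≤ predictionDistance w A B ∧
        δ * (Real.log k * optCost w k B + predictionDistance w A B) < R.expectedCost w A B) ∧
    (∀ (f : ℕ → ℝ) (g : ℕ → ℝ → ℝ),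
      f =o[atTop] (fun k : ℕ => (k : ℝ)) → (∀ k, g k =o[atTop] (fun x : ℝ => x)) →
      ¬ ∃ a : (k n : ℕ) → 1 ≤ k → k < n → DetAlg n k,
        ∀ (k n : ℕ) (hk : 1 ≤ k) (hn : k < n) (w : Fin n → ℝ) (A B : List (Fin n)),
          (∀ p, 0 < w p) →
          (a k n hk hn).cost w A B ≤ f k * optCost w k B + g k (predictionDistance w A B)) ∧
    (∀ (f : ℕ → ℝ) (g : ℕ → ℝ → ℝ),
      f =o[atTop] (fun k : ℕ => Real.log k) → (∀ k, g k =o[atTop] (fun x : ℝ => x)) →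
      ¬ ∃ R : (k n : ℕ) → 1 ≤ k → k < n → RandAlg n k,
        ∀ (k n : ℕ) (hk : 1 ≤ k) (hn : k < n) (w : Fin n → ℝ) (A B : List (Fin n)),
          (∀ p, 0 < w p) →
          (R k n hk hn).expectedCost w A B
            ≤ f k * optCost w k B + g k (predictionDistance w A B)) ∧
    (∀ c : ℝ, ¬ ∃ R : (k n : ℕ) → 1 ≤ k → k < n → RandAlg n k,
        ∀ (k n : ℕ) (hk : 1 ≤ k) (hn : k < n) (w : Fin n → ℝ) (A B : List (Fin n)),
          (∀ p, 0 < w p) →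
          (R k n hk hn).expectedCost w A B
            ≤ c * (optCost w k B + √(predictionDistance w A B * optCost w k B))) := by
  refine ⟨⟨1 / 20, by norm_num, fun k n hk h a X => exists_instance_deterministic hk h a X⟩,
    ⟨1 / 20, by norm_num, fun k n hk h R X => exists_instance_randomized hk h R X⟩, ?_, ?_, ?_⟩
  · rintro f g hf hg ⟨a, ha⟩
    obtain ⟨k, hfk, hk⟩ := ((isLittleO_eventually_le hf (Eventually.of_forall fun k =>
      Nat.cast_nonneg k) (by norm_num : (0 : ℝ) < 1 / 20)).and (eventually_ge_atTop 1)).exists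
    obtain ⟨X, hX⟩ := eventually_atTop.1 (isLittleO_eventually_le (hg k)
      (eventually_ge_atTop (0 : ℝ)) (by norm_num : (0 : ℝ) < 1 / 20))
    obtain ⟨w, A, B, hw, hXd, hcost⟩ :=
      exists_instance_deterministic hk (Nat.lt_succ_self k) (a k (k + 1) hk (Nat.lt_succ_self k)) X
    have h1 := ha k (k + 1) hk (Nat.lt_succ_self k) w A B hw
    have h2 := hX _ hXd
    have h3 := mul_le_mul_of_nonneg_right hfk (optCost_nonneg (fun p => (hw p).le) k B)
    linarith
  · rintro f g hf hg ⟨R, hR⟩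
    obtain ⟨k, hfk, hk⟩ := ((isLittleO_eventually_le hf (Eventually.of_forall fun k =>
      Real.log_natCast_nonneg k) (by norm_num : (0 : ℝ) < 1 / 20)).and
      (eventually_ge_atTop 1)).exists
    obtain ⟨X, hX⟩ := eventually_atTop.1 (isLittleO_eventually_le (hg k)
      (eventually_ge_atTop (0 : ℝ)) (by norm_num : (0 : ℝ) < 1 / 20))
    obtain ⟨w, A, B, hw, hXd, hcost⟩ :=
      exists_instance_randomized hk (Nat.lt_succ_self k) (R k (k + 1) hk (Nat.lt_succ_self k)) X
    have h1 := hR k (k + 1) hk (Nat.lt_succ_self k) w A B hw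
    have h2 := hX _ hXd
    have h3 := mul_le_mul_of_nonneg_right hfk (optCost_nonneg (fun p => (hw p).le) k B)
    linarith
  · rintro c ⟨R, hR⟩
    -- The term `|c|` absorbs `c * OPT`; the term `5 * |c| ^ 2` absorbs what the inequality of
    -- arithmetic and geometric means leaves of the square root after 1/20 of the prediction
    -- distance is split off.
    obtain ⟨k, hlog, hk⟩ := (((Real.tendsto_log_atTop.comp
      tendsto_natCast_atTop_atTop).eventually_ge_atTop (20 * (|c| + 5 * |c| ^ 2))).and
      (eventually_ge_atTop 1)).exists
    obtain ⟨w, A, B, hw, -, hcost⟩ :=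
      exists_instance_randomized hk (Nat.lt_succ_self k) (R k (k + 1) hk (Nat.lt_succ_self k)) 0
    have h1 := hR k (k + 1) hk (Nat.lt_succ_self k) w A B hw
    have hO := optCost_nonneg (fun p => (hw p).le) k B
    have hP := predictionDistance_nonneg (fun p => (hw p).le) A B
    have h2 : c * (optCost w k B + √(predictionDistance w A B * optCost w k B)) ≤
        |c| * (optCost w k B + √(predictionDistance w A B * optCost w k B)) :=
      mul_le_mul_of_nonneg_right (le_abs_self c) (add_nonneg hO (Real.sqrt_nonneg _))
    have h3 : |c| * √(predictionDistance w A B * optCost w k B) ≤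
        1 / 20 * predictionDistance w A B + 5 * |c| ^ 2 * optCost w k B := by
      rw [Real.sqrt_mul hP]
      have hx := Real.sq_sqrt hP
      have hy := Real.sq_sqrt hO
      nlinarith [sq_nonneg (√(predictionDistance w A B) - 10 * |c| * √(optCost w k B))]
    have h4 := mul_le_mul_of_nonneg_right hlog hO
    simp only [Function.comp_apply] at h4
    linarith
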